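/- Let $p$ be a prime, let $m\ge 0$ be an integer, and let $F_0$ be a field whose characteristic is either $0$ or at least $p$. If $\operatorname{char}(F_0)\neq p$, assume that $F_0$ contains a primitive $p$-th root of unity $\rho$. Let $F$ be either the field $F_0(\alpha_1,\beta_1,\dots,\alpha_m,\beta_m)$ of rational functions in $2m$ independent indeterminates or the field of iterated Laurent series $F_0(\!(\alpha_1^{-1})\!)(\!(\beta_1^{-1})\!)\cdots(\!(\alpha_m^{-1})\!)(\!(\beta_m^{-1})\!)$. Define the $F$-algebra $A$ as follows. - If $\operatorname{char}(F_0)\neq p$, let $A=(\alpha_1,\beta_1)_{p,F}\otimes_F\cdots\otimes_F(\alpha_m,\beta_m)_{p,F}$, where $(\alpha,\beta)_{p,F}=F\langle x,y : x^p=\alpha,\ y^p=\beta,\ yxy^{-1}=\rho x\rangle$. - If $\operatorname{char}(F_0)=p$, let $A=[\alpha_1,\beta_1)_{p,F}\otimes_F\cdots\otimes_F[\alpha_m,\beta_m)_{p,F}$, where $[\alpha,\beta)_{p,F}=F\langle x,y : x^p-x=\alpha,\ y^p=\beta,\ yxy^{-1}=x+1\rangle$. Let $\operatorname{Tr}:A\to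 F$ be the reduced trace, i.e. the matrix trace under an isomorphism $A\otimes_F K\cong M_{p^m}(K)$, where $K$ is an algebraic closure of $F$. Then every $F$-linear subspace $V\subseteq A$ such that $\operatorname{Tr}(v^{p-1})=0$ for all $v\in V$ satisfies $$\dim_F V\le \frac{p^{2m}-1}{p-1}.$$ -/

import Mathlib

open scoped TensorProduct

universe u

noncomputable section

/-- Relations of the symbol algebra `(α, β)_{p,F}` (characteristic different from `p`, `ρ` a primitive
`p`-th root of unity) on the free generators `x = ι 0`, `y = ι 1`. For `β ≠ 0` the element `y` is
invertible, so that `y x = ρ x y` is the relation `y x y⁻¹ = ρ x`. -/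
inductive SymbolRel {F : Type u} [Field F] (p : ℕ) (ρ α β : F) :
    FreeAlgebra F (Fin 2) → FreeAlgebra F (Fin 2) → Prop
  | x_pow : SymbolRel p ρ α β (FreeAlgebra.ι F 0 ^ p) (algebraMap F _ α)
  | y_pow : SymbolRel p ρ α β (FreeAlgebra.ι F 1 ^ p) (algebraMap F _ β)
  | comm : SymbolRel p ρ α β (FreeAlgebra.ι F 1 * FreeAlgebra.ι F 0)
      (algebraMap F _ ρ * FreeAlgebra.ι F 0 * FreeAlgebra.ι F 1)

/-- The symbol algebra
`(α, β)_{p,F} = F⟨x, y : x ^ p = α, y ^ p = β, y x y⁻¹ = ρ x⟩` (for `char F ≠ p`). -/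
def SymbolAlgebra {F : Type u} [Field F] (p : ℕ) (ρ α β : F) : Type u :=
  RingQuot (SymbolRel p ρ α β)

instance {F : Type u} [Field F] (p : ℕ) (ρ α β : F) : Ring (SymbolAlgebra p ρ α β) :=
  inferInstanceAs (Ring (RingQuot (SymbolRel p ρ α β)))

instance {F : Type u} [Field F] (p : ℕ) (ρ α β : F) : Algebra F (SymbolAlgebra p ρ α β) :=
  inferInstanceAs (Algebra F (RingQuot (SymbolRel p ρ α β)))

/-- Relations of the symbol algebra `[α, β)_{p,F}` (characteristic `p`) on the free generators
`x = ι 0`, `y = ι 1`. For `β ≠ 0` the element `y` is invertible, so that `y x = (x + 1) y` is the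
relation `y x y⁻¹ = x + 1`. -/
inductive CharPSymbolRel {F : Type u} [Field F] (p : ℕ) (α β : F) :
    FreeAlgebra F (Fin 2) → FreeAlgebra F (Fin 2) → Prop
  | x_pow : CharPSymbolRel p α β (FreeAlgebra.ι F 0 ^ p - FreeAlgebra.ι F 0) (algebraMap F _ α)
  | y_pow : CharPSymbolRel p α β (FreeAlgebra.ι F 1 ^ p) (algebraMap F _ β)
  | comm : CharPSymbolRel p α β (FreeAlgebra.ι F 1 * FreeAlgebra.ι F 0)
      ((FreeAlgebra.ι F 0 + 1) * FreeAlgebra.ι F 1)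

/-- The symbol algebra
`[α, β)_{p,F} = F⟨x, y : x ^ p - x = α, y ^ p = β, y x y⁻¹ = x + 1⟩` (for `char F = p`). -/
def CharPSymbolAlgebra {F : Type u} [Field F] (p : ℕ) (α β : F) : Type u :=
  RingQuot (CharPSymbolRel p α β)

instance {F : Type u} [Field F] (p : ℕ) (α β : F) : Ring (CharPSymbolAlgebra p α β) :=
  inferInstanceAs (Ring (RingQuot (CharPSymbolRel p α β)))

instance {F : Type u} [Field F] (p : ℕ) (α β : F) : Algebra F (CharPSymbolAlgebra p α β) :=
  inferInstanceAs (Algebra F (RingQuot (CharPSymbolRel p α β)))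

/-- The tensor product `(α₁, β₁)_{p,F} ⊗ ⋯ ⊗ (αₘ, βₘ)_{p,F}` over `F`. -/
abbrev SymbolTensor {F : Type u} [Field F] (p m : ℕ) (ρ : F) (α β : Fin m → F) : Type u :=
  ⨂[F] i : Fin m, SymbolAlgebra p ρ (α i) (β i)

/-- The tensor product `[α₁, β₁)_{p,F} ⊗ ⋯ ⊗ [αₘ, βₘ)_{p,F}` over `F`. -/
abbrev CharPSymbolTensor {F : Type u} [Field F] (p m : ℕ) (α β : Fin m → F) : Type u :=
  ⨂[F] i : Fin m, CharPSymbolAlgebra p (α i) (β i)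

/-- `t : F` is the trace of `a` in a matrix algebra over the algebraic closure `K` of `F` under some
splitting `K ⊗ A ≃ M_d(K)`. -/
def IsReducedTrace (F : Type u) [Field F] {A : Type u} [Ring A] [Algebra F A] (a : A) (t : F) :
    Prop :=
  ∃ (d : ℕ) (e : AlgebraicClosure F ⊗[F] A ≃ₐ[AlgebraicClosure F]
      Matrix (Fin d) (Fin d) (AlgebraicClosure F)),
    (e (1 ⊗ₜ[F] a)).trace = algebraMap F (AlgebraicClosure F) t

open Classical in
/-- The reduced trace `A → F` of a central simple `F`-algebra `A`. (The value does not depend on the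
splitting; where there is no value in `F`, which does not happen for central simple `A`, it is set
to `0`.) -/
def reducedTrace (F : Type u) [Field F] {A : Type u} [Ring A] [Algebra F A] (a : A) : F :=
  if h : ∃ t : F, IsReducedTrace F a t then h.choose else 0

/-- The rational function field `F₀(α₁, β₁, …, αₘ, βₘ)` in `2m` independent indeterminates. -/
abbrev RatField (m : ℕ) (F₀ : Type u) [Field F₀] : Type u :=
  FractionRing (MvPolynomial (Fin m ⊕ Fin m) F₀)

namespace RatField

/-- The indeterminate `αᵢ`. -/
def alpha (m : ℕ) (F₀ : Type u) [Field F₀] (i : Fin m) : RatField m F₀ :=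
  algebraMap (MvPolynomial (Fin m ⊕ Fin m) F₀) _ (MvPolynomial.X (Sum.inl i))

/-- The indeterminate `βᵢ`. -/
def beta (m : ℕ) (F₀ : Type u) [Field F₀] (i : Fin m) : RatField m F₀ :=
  algebraMap (MvPolynomial (Fin m ⊕ Fin m) F₀) _ (MvPolynomial.X (Sum.inr i))

end RatField

/-- The iterated Laurent series field `K((α₁⁻¹))((β₁⁻¹))⋯((αₘ⁻¹))((βₘ⁻¹))`. The recursion adjoins the
innermost pair of variables first. -/
def IterLaurent : (m : ℕ) → (K : Type u) → [Field K] → Type u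
  | 0, K, _ => K
  | m + 1, K, _ => IterLaurent m (LaurentSeries (LaurentSeries K))

namespace IterLaurent

instance instField : (m : ℕ) → (K : Type u) → [Field K] → Field (IterLaurent m K)
  | 0, _, h => h
  | m + 1, K, _ => instField m (LaurentSeries (LaurentSeries K))

/-- The embedding of the field of constants `K`. -/
def const : (m : ℕ) → (K : Type u) → [Field K] → (K →+* IterLaurent m K)
  | 0, K, _ => RingHom.id K
  | m + 1, K, _ => (const m (LaurentSeries (LaurentSeries K))).comp
      ((HahnSeries.C : LaurentSeries K →+* LaurentSeries (LaurentSeries K)).comp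
        (HahnSeries.C : K →+* LaurentSeries K))

/-- The element `αᵢ`, the inverse of the Laurent series variable `αᵢ⁻¹`. -/
def alpha : (m : ℕ) → (K : Type u) → [Field K] → Fin m → IterLaurent m K
  | 0, _, _ => Fin.elim0
  | m + 1, K, _ => Fin.cons
      (const m (LaurentSeries (LaurentSeries K))
        (HahnSeries.C (HahnSeries.single (-1 : ℤ) (1 : K) : LaurentSeries K)))
      (alpha m (LaurentSeries (LaurentSeries K)))

/-- The element `βᵢ`, the inverse of the Laurent series variable `βᵢ⁻¹`. -/
def beta : (m : ℕ) → (K : Type u) → [Field K] → Fin m → IterLaurent m K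
  | 0, _, _ => Fin.elim0
  | m + 1, K, _ => Fin.cons
      (const m (LaurentSeries (LaurentSeries K))
        (HahnSeries.single (-1 : ℤ) (1 : LaurentSeries K)))
      (beta m (LaurentSeries (LaurentSeries K)))

end IterLaurent

end

/-! The field `F` carries a valuation, trivial on the constants `F₀`, for which the values of the
`αᵢ` and `βᵢ` are independent. It extends to `A` by giving `xᵢ` and `yᵢ` one `p`-th of the values of
`αᵢ` and `βᵢ`; to avoid division, all values on `A` are multiplied by `p`, so a scalar `c` has value
`p • v c`. The monomials in the `xᵢ`, `yᵢ` then have values that are distinct modulo `p • Γ`, with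
classes filling `G = (ℤ/p)^(2m)`. Hence every nonzero element has a single leading monomial, values
add exactly under multiplication, and `dim V` is at most the size of the set `S ⊆ G` of classes of
values of nonzero elements of `V`.

Exactly one monomial has nonzero trace: `1` if the characteristic is not `p`, and `∏ xᵢ ^ (p - 1)`
if it is. Write its class as `(p - 1) • e`; thus `e = 0` in the first case and `e = (1, 0)` in every
factor in the second. An element whose value has class `(p - 1) • e` has nonzero trace. So `e ∉ S`,
by looking at `a ^ (p - 1)`.

Moreover, two distinct `s, t ∈ S` never lie on one line through `e`. Otherwise there are `i + j = p
- 1` with `i • s + j • t = (p - 1) • e`. For `a, b ∈ V` of classes `s, t`, the trace of `(a + c b) ^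
(p - 1)` is a polynomial in `c` of degree less than `p` that vanishes at `0, …, p - 1`, so its
coefficient at `c ^ j` is zero. That coefficient is the trace of the sum of all words in `i` letters
`a` and `j` letters `b`. Since `a` and `b` commute up to higher terms, the sum agrees to leading
order with a nonzero binomial coefficient times `a ^ i * b ^ j`, whose class is `(p - 1) • e`: a
contradiction. Therefore `S` injects into the projective space of lines of `G` through `e`, which
has `(p ^ (2m) - 1) / (p - 1)` points.

The commutation has two sources. If `e = 0`, the leading monomial of `b` is proportional to that of
a power of `a`. In characteristic `p`, everything commutes to leading order, because `y x - x y = y`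
has larger value than `y x` as soon as `v α < 0`.

The counting argument is `IsGradedUnitBasis.rank_le`, resting on `coeff_add_pow_sub_mem`;
`rank_le_of_symbolGens` feeds symbol algebras into it, and `IterLaurent.exists_indepValuation`
provides the valuation. -/

noncomputable section

/-! ### Valuations in ordered groups -/

/-- A valuation on a field with values in an ordered group; the value at `0` is irrelevant. -/
structure OrdVal (F : Type*) [Field F] (Γ : Type*) [AddCommGroup Γ] [LinearOrder Γ] where
  val : F → Γ
  map_mul : ∀ a b, a ≠ 0 → b ≠ 0 → val (a * b) = val a + val b
  map_add : ∀ a b, a ≠ 0 → b ≠ 0 → a + b ≠ 0 → min (val a) (val b) ≤ val (a + b)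

namespace OrdVal

variable {F : Type*} [Field F] {Γ : Type*} [AddCommGroup Γ] [LinearOrder Γ]
  (v : OrdVal F Γ)

theorem val_one : v.val 1 = 0 := by
  have h := v.map_mul 1 1 one_ne_zero one_ne_zero
  simpa using h

theorem val_inv {a : F} (ha : a ≠ 0) : v.val a⁻¹ = - v.val a := by
  have h := v.map_mul a a⁻¹ ha (inv_ne_zero ha)
  rw [mul_inv_cancel₀ ha, val_one] at h
  exact (neg_eq_of_add_eq_zero_right h.symm).symm

theorem val_pow {a : F} (ha : a ≠ 0) (n : ℕ) : v.val (a ^ n) = n • v.val a := by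
  induction n with
  | zero => simp [val_one]
  | succ n ih => rw [pow_succ, v.map_mul _ _ (pow_ne_zero n ha) ha, ih, succ_nsmul]

theorem val_prod {ι : Type*} (s : Finset ι) (f : ι → F) (hf : ∀ i ∈ s, f i ≠ 0) :
    v.val (∏ i ∈ s, f i) = ∑ i ∈ s, v.val (f i) := by
  classical
  induction s using Finset.induction_on with
  | empty => simp [val_one]
  | insert i s hi ih =>
    have h1 : ∀ j ∈ s, f j ≠ 0 := fun j hj => hf j (Finset.mem_insert_of_mem hj)
    rw [Finset.prod_insert hi, Finset.sum_insert hi,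
      v.map_mul _ _ (hf i (Finset.mem_insert_self i s)) (Finset.prod_ne_zero_iff.2 h1), ih h1]

/-- The pullback of a valuation along a homomorphism of fields. -/
def comap {E : Type*} [Field E] (f : E →+* F) : OrdVal E Γ where
  val a := v.val (f a)
  map_mul a b ha hb := by
    rw [_root_.map_mul]
    exact v.map_mul _ _ (by simpa using ha) (by simpa using hb)
  map_add a b ha hb hab := by
    rw [_root_.map_add]
    refine v.map_add _ _ (by simpa using ha) (by simpa using hb) ?_
    rw [← _root_.map_add]
    exact (map_ne_zero f).2 hab

theorem val_neg [IsOrderedAddMonoid Γ] (a : F) : v.val (-a) = v.val a := by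
  by_cases ha : a = 0
  · simp [ha]
  have h1 : v.val (-1) = 0 := by
    have h := v.map_mul (-1) (-1) (by simp) (by simp)
    rw [neg_mul_neg, one_mul, v.val_one] at h
    have h' : (2 : ℕ) • v.val (-1) = 0 := by rw [two_nsmul]; exact h.symm
    exact (nsmul_eq_zero_iff.1 h').resolve_right two_ne_zero
  have h := v.map_mul (-1) a (by simp) ha
  rw [h1, zero_add, neg_one_mul] at h
  exact h

variable [IsOrderedAddMonoid Γ]

theorem le_nsmul_val_add {p : ℕ} {γ w : Γ} {a b : F} (ha : a ≠ 0 → γ ≤ p • v.val a + w)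
    (hb : b ≠ 0 → γ ≤ p • v.val b + w) (h : a + b ≠ 0) : γ ≤ p • v.val (a + b) + w := by
  by_cases h1 : a = 0
  · simp only [h1, zero_add] at h ⊢
    exact hb h
  by_cases h2 : b = 0
  · simp only [h2, add_zero] at h ⊢
    exact ha h
  rcases min_le_iff.1 (v.map_add _ _ h1 h2 h) with h3 | h3
  · exact (ha h1).trans (by gcongr)
  · exact (hb h2).trans (by gcongr)

theorem lt_nsmul_val_add {p : ℕ} {γ w : Γ} {a b : F} (ha : a ≠ 0 → γ < p • v.val a + w)
    (hb : b ≠ 0 → γ < p • v.val b + w) (h : a + b ≠ 0) : γ < p • v.val (a + b) + w := by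
  by_cases h1 : a = 0
  · simp only [h1, zero_add] at h ⊢
    exact hb h
  by_cases h2 : b = 0
  · simp only [h2, add_zero] at h ⊢
    exact ha h
  rcases min_le_iff.1 (v.map_add _ _ h1 h2 h) with h3 | h3
  · exact (ha h1).trans_le (by gcongr)
  · exact (hb h2).trans_le (by gcongr)

end OrdVal

/-! ### The filtration of an algebra defined by a weighted basis -/

section Filtration

variable {F : Type*} [Field F] {Γ : Type*} [AddCommGroup Γ] [LinearOrder Γ]
  [IsOrderedAddMonoid Γ] (v : OrdVal F Γ) (p : ℕ)
  {A : Type*} [Ring A] [Algebra F A] {κ : Type*} (B : Module.Basis κ F A) (ω : κ → Γ)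

/-- The elements of value at least `γ`, when `B g` is given the value `ω g` and a scalar `c` the
value `p • v c`. -/
def filGE (γ : Γ) : AddSubgroup A where
  carrier := {a | ∀ g, B.repr a g ≠ 0 → γ ≤ p • v.val (B.repr a g) + ω g}
  zero_mem' := by simp
  neg_mem' {a} ha g := by
    intro h
    simp only [map_neg, Finsupp.coe_neg, Pi.neg_apply, ne_eq, neg_eq_zero] at h
    simpa [v.val_neg] using ha g h
  add_mem' {a b} ha hb g := by
    intro h
    simp only [map_add, Finsupp.coe_add, Pi.add_apply] at h ⊢
    exact v.le_nsmul_val_add (ha g) (hb g) h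

/-- The elements of value greater than `γ`. -/
def filGT (γ : Γ) : AddSubgroup A where
  carrier := {a | ∀ g, B.repr a g ≠ 0 → γ < p • v.val (B.repr a g) + ω g}
  zero_mem' := by simp
  neg_mem' {a} ha g := by
    intro h
    simp only [map_neg, Finsupp.coe_neg, Pi.neg_apply, ne_eq, neg_eq_zero] at h
    simpa [v.val_neg] using ha g h
  add_mem' {a b} ha hb g := by
    intro h
    simp only [map_add, Finsupp.coe_add, Pi.add_apply] at h ⊢
    exact v.lt_nsmul_val_add (ha g) (hb g) h

variable {v p B ω}

theorem mem_filGE {γ : Γ} {a : A} : a ∈ filGE v p B ω γ ↔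
    ∀ g, B.repr a g ≠ 0 → γ ≤ p • v.val (B.repr a g) + ω g := Iff.rfl

theorem mem_filGT {γ : Γ} {a : A} : a ∈ filGT v p B ω γ ↔
    ∀ g, B.repr a g ≠ 0 → γ < p • v.val (B.repr a g) + ω g := Iff.rfl

theorem filGT_le_filGE (γ : Γ) : filGT v p B ω γ ≤ filGE v p B ω γ :=
  fun _ ha g hg => (ha g hg).le

theorem filGE_le_filGT {γ δ : Γ} (h : γ < δ) : filGE v p B ω δ ≤ filGT v p B ω γ :=
  fun _ ha g hg => h.trans_le (ha g hg)

theorem filGE_anti {γ δ : Γ} (h : γ ≤ δ) : filGE v p B ω δ ≤ filGE v p B ω γ :=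
  fun _ ha g hg => h.trans (ha g hg)

theorem basis_mem_filGE (g : κ) : B g ∈ filGE v p B ω (ω g) := by
  classical
  intro h hh
  rw [B.repr_self, Finsupp.single_apply] at hh ⊢
  split_ifs at hh ⊢ with h1
  · subst h1; simp [v.val_one]
  · simp at hh

theorem smul_mem_filGE {γ : Γ} {a : A} (ha : a ∈ filGE v p B ω γ) {c : F} (hc : c ≠ 0) :
    c • a ∈ filGE v p B ω (p • v.val c + γ) := by
  intro g hg
  simp only [map_smul, Finsupp.smul_apply, smul_eq_mul] at hg ⊢
  have h2 := right_ne_zero_of_mul hg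
  rw [v.map_mul _ _ hc h2, smul_add, add_assoc]
  gcongr
  exact ha g h2

theorem smul_mem_filGT {γ : Γ} {a : A} (ha : a ∈ filGT v p B ω γ) {c : F} (hc : c ≠ 0) :
    c • a ∈ filGT v p B ω (p • v.val c + γ) := by
  intro g hg
  simp only [map_smul, Finsupp.smul_apply, smul_eq_mul] at hg ⊢
  have h2 := right_ne_zero_of_mul hg
  rw [v.map_mul _ _ hc h2, smul_add, add_assoc]
  gcongr
  exact ha g h2

/-- A nonzero element has a value. -/
theorem exists_mem_filGE_notMem_filGT {a : A} (ha : a ≠ 0) :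
    ∃ γ, a ∈ filGE v p B ω γ ∧ a ∉ filGT v p B ω γ := by
  have hs : (B.repr a).support.Nonempty := by
    rw [Finsupp.support_nonempty_iff]
    simpa using ha
  obtain ⟨g, hg, hmin⟩ := Finset.exists_min_image (B.repr a).support
    (fun g => p • v.val (B.repr a g) + ω g) hs
  refine ⟨p • v.val (B.repr a g) + ω g, fun h hh => hmin h (by simpa using hh), fun h => ?_⟩
  exact lt_irrefl _ (h g (by simpa using hg))

theorem exists_repr_of_notMem_filGT {γ : Γ} {a : A} (h1 : a ∈ filGE v p B ω γ)
    (h2 : a ∉ filGT v p B ω γ) :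
    ∃ g, B.repr a g ≠ 0 ∧ p • v.val (B.repr a g) + ω g = γ := by
  rw [mem_filGT] at h2
  push Not at h2
  obtain ⟨g, hg, hle⟩ := h2
  exact ⟨g, hg, le_antisymm hle (h1 g hg)⟩

variable [Finite κ]

section Mul

variable (hmul : ∀ g h, B g * B h ∈ filGE v p B ω (ω g + ω h))
include hmul

theorem mul_mem_filGE {γ δ : Γ} {a b : A} (ha : a ∈ filGE v p B ω γ)
    (hb : b ∈ filGE v p B ω δ) : a * b ∈ filGE v p B ω (γ + δ) := by
  classical
  have := Fintype.ofFinite κ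
  rw [← B.sum_repr a, ← B.sum_repr b, Finset.sum_mul_sum]
  refine sum_mem fun g _ => sum_mem fun h _ => ?_
  by_cases h1 : B.repr a g = 0
  · simp [h1]
  by_cases h2 : B.repr b h = 0
  · simp [h2]
  rw [smul_mul_smul_comm]
  refine filGE_anti ?_ (smul_mem_filGE (hmul g h) (mul_ne_zero h1 h2))
  rw [v.map_mul _ _ h1 h2]
  calc γ + δ ≤ (p • v.val (B.repr a g) + ω g) + (p • v.val (B.repr b h) + ω h) :=
        add_le_add (ha g h1) (hb h h2)
    _ = _ := by rw [smul_add]; abel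

/-- A nonzero element of value greater than `γ` has an exact value `γ' > γ`, since its expansion in
the basis is finite; this reduces the strict statement to the weak one. -/
theorem mul_mem_filGT_left {γ δ : Γ} {a b : A} (ha : a ∈ filGT v p B ω γ)
    (hb : b ∈ filGE v p B ω δ) : a * b ∈ filGT v p B ω (γ + δ) := by
  by_cases h0 : a = 0
  · simp [h0, (filGT v p B ω (γ + δ)).zero_mem]
  obtain ⟨γ', h1, h2⟩ := exists_mem_filGE_notMem_filGT (v := v) (p := p) (B := B) (ω := ω) h0
  obtain ⟨g, hg, hg'⟩ := exists_repr_of_notMem_filGT h1 h2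
  have h3 : γ < γ' := hg' ▸ ha g hg
  exact filGE_le_filGT (by gcongr) (mul_mem_filGE hmul h1 hb)

theorem mul_mem_filGT_right {γ δ : Γ} {a b : A} (ha : a ∈ filGE v p B ω γ)
    (hb : b ∈ filGT v p B ω δ) : a * b ∈ filGT v p B ω (γ + δ) := by
  by_cases h0 : b = 0
  · simp [h0, (filGT v p B ω (γ + δ)).zero_mem]
  obtain ⟨γ', h1, h2⟩ := exists_mem_filGE_notMem_filGT (v := v) (p := p) (B := B) (ω := ω) h0
  obtain ⟨g, hg, hg'⟩ := exists_repr_of_notMem_filGT h1 h2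
  have h3 : δ < γ' := hg' ▸ hb g hg
  exact filGE_le_filGT (by gcongr) (mul_mem_filGE hmul ha h1)

theorem pow_mem_filGE (hone : (1 : A) ∈ filGE v p B ω 0) {γ : Γ} {a : A}
    (ha : a ∈ filGE v p B ω γ) (n : ℕ) : a ^ n ∈ filGE v p B ω (n • γ) := by
  induction n with
  | zero => simpa using hone
  | succ n ih => rw [pow_succ, succ_nsmul]; exact mul_mem_filGE hmul ih ha

end Mul

/-- The filtration defined by `B` and `ω` is multiplicative and each `B g` is a homogeneous unit. -/
structure IsGradedUnitBasis (v : OrdVal F Γ) (p : ℕ) (B : Module.Basis κ F A) (ω : κ → Γ) :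
    Prop where
  exists_one : ∃ g, B g = 1 ∧ ω g = 0
  mul_mem : ∀ g h, B g * B h ∈ filGE v p B ω (ω g + ω h)
  exists_inv : ∀ g, ∃ u ∈ filGE v p B ω (-ω g), u * B g = 1
  sep : ∀ g h (γ δ : Γ), p • γ + ω g = p • δ + ω h → g = h

/-- `a` has the exact value `γ`. -/
def HasValue (v : OrdVal F Γ) (p : ℕ) (B : Module.Basis κ F A) (ω : κ → Γ) (a : A) (γ : Γ) : Prop :=
  a ∈ filGE v p B ω γ ∧ a ∉ filGT v p B ω γ

omit [Finite κ] in
theorem HasValue.add {γ : Γ} {a b : A} (ha : HasValue v p B ω a γ) (hb : b ∈ filGT v p B ω γ) :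
    HasValue v p B ω (a + b) γ := by
  refine ⟨add_mem ha.1 (filGT_le_filGE _ hb), fun h => ha.2 ?_⟩
  simpa using sub_mem h hb

omit [Finite κ] in
theorem HasValue.smul {γ : Γ} {a : A} (ha : HasValue v p B ω a γ) {c : F} (hc : c ≠ 0) :
    HasValue v p B ω (c • a) (p • v.val c + γ) := by
  refine ⟨smul_mem_filGE ha.1 hc, fun h => ha.2 ?_⟩
  have h1 := smul_mem_filGT h (inv_ne_zero hc)
  rw [inv_smul_smul₀ hc, v.val_inv hc] at h1
  convert h1 using 2
  rw [smul_neg]; abel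

omit [Finite κ] in
theorem hasValue_basis (g : κ) : HasValue v p B ω (B g) (ω g) := by
  refine ⟨basis_mem_filGE g, fun h => ?_⟩
  have := h g (by simp)
  simp [v.val_one] at this

namespace IsGradedUnitBasis

variable (H : IsGradedUnitBasis v p B ω)
include H

omit [Finite κ] in
theorem hasValue_one : HasValue v p B ω (1 : A) 0 := by
  obtain ⟨g, hg, hg'⟩ := H.exists_one
  rw [← hg, ← hg']
  exact hasValue_basis g

omit [Finite κ] in
-- By `sep`, two basis elements cannot contribute terms of the same value, so the minimum is
-- attained exactly once. This makes the graded pieces one-dimensional in effect.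
theorem exists_leading_term {γ : Γ} {a : A} (ha : HasValue v p B ω a γ) :
    ∃ g, ∃ c : F, c ≠ 0 ∧ B.repr a g = c ∧ p • v.val c + ω g = γ ∧
      a - c • B g ∈ filGT v p B ω γ := by
  classical
  obtain ⟨g, hg, hγ⟩ := exists_repr_of_notMem_filGT ha.1 ha.2
  refine ⟨g, B.repr a g, hg, rfl, hγ, fun h hh => ?_⟩
  simp only [map_sub, map_smul, B.repr_self, Finsupp.coe_sub, Finsupp.coe_smul, Pi.sub_apply,
    Pi.smul_apply, Finsupp.single_apply, smul_eq_mul] at hh ⊢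
  by_cases hgh : g = h
  · simp [hgh] at hh
  · simp only [hgh, if_false, mul_zero, sub_zero] at hh ⊢
    refine lt_of_le_of_ne (ha.1 h hh) fun heq => hgh ?_
    exact H.sep _ _ _ _ (hγ.trans heq)

/-- If `a * b` had too large a value, cancelling the leading term of `a` with its homogeneous
inverse would give `b` too large a value. -/
theorem hasValue_mul {γ δ : Γ} {a b : A} (ha : HasValue v p B ω a γ)
    (hb : HasValue v p B ω b δ) : HasValue v p B ω (a * b) (γ + δ) := by
  refine ⟨mul_mem_filGE H.mul_mem ha.1 hb.1, fun h => hb.2 ?_⟩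
  obtain ⟨g, c, hc, -, hγ, hrest⟩ := H.exists_leading_term ha
  obtain ⟨u, hu, hug⟩ := H.exists_inv g
  have h1 : c • B g * b ∈ filGT v p B ω (γ + δ) := by
    have := sub_mem h (mul_mem_filGT_left H.mul_mem hrest hb.1)
    rwa [← sub_mul, sub_sub_cancel] at this
  have h2 := mul_mem_filGT_right H.mul_mem (smul_mem_filGE hu (inv_ne_zero hc)) h1
  have h3 : c⁻¹ • u * (c • B g * b) = b := by
    rw [← mul_assoc, smul_mul_smul_comm, inv_mul_cancel₀ hc, hug, one_smul, one_mul]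
  rw [h3, v.val_inv hc, ← hγ] at h2
  convert h2 using 2
  rw [smul_neg]; abel

theorem hasValue_pow {γ : Γ} {a : A} (ha : HasValue v p B ω a γ) (n : ℕ) :
    HasValue v p B ω (a ^ n) (n • γ) := by
  induction n with
  | zero => simpa using H.hasValue_one
  | succ n ih => rw [pow_succ, succ_nsmul]; exact H.hasValue_mul ih ha

/-- If `a` and `b` commute up to terms of higher value, the coefficient of `X ^ j` in
`(a + b X) ^ (i + j)` is `(i + j).choose j • a ^ i * b ^ j` up to terms of higher value. -/
theorem coeff_add_pow_sub_mem {γ δ : Γ} {a b : A} (ha : a ∈ filGE v p B ω γ)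
    (hb : b ∈ filGE v p B ω δ) (hab : b * a - a * b ∈ filGT v p B ω (γ + δ)) (i j : ℕ) :
    ((Polynomial.C a + Polynomial.C b * Polynomial.X) ^ (i + j)).coeff j -
      (i + j).choose j • (a ^ i * b ^ j) ∈ filGT v p B ω (i • γ + j • δ) := by
  have hone : (1 : A) ∈ filGE v p B ω 0 := H.hasValue_one.1
  have hpow {γ : Γ} {a : A} (ha : a ∈ filGE v p B ω γ) (n : ℕ) := pow_mem_filGE H.mul_mem hone ha n
  have hcomm : ∀ i, b * a ^ i - a ^ i * b ∈ filGT v p B ω (i • γ + δ) := by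
    intro i
    induction i with
    | zero => simp
    | succ i ih =>
      have e : b * a ^ (i + 1) - a ^ (i + 1) * b =
          (b * a ^ i - a ^ i * b) * a + a ^ i * (b * a - a * b) := by
        rw [pow_succ]; noncomm_ring
      rw [e]
      refine add_mem ?_ ?_
      · convert mul_mem_filGT_left H.mul_mem ih ha using 2
        rw [succ_nsmul]; abel
      · convert mul_mem_filGT_right H.mul_mem (hpow ha i) hab using 2
        rw [succ_nsmul]; abel
  set P := Polynomial.C a + Polynomial.C b * Polynomial.X with hP
  have hz : ∀ n, (P ^ n).coeff 0 = a ^ n := by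
    intro n
    induction n with
    | zero => simp
    | succ n ih => rw [pow_succ, Polynomial.mul_coeff_zero, ih, hP]; simp [pow_succ]
  -- Pascal's recursion, with the new factor on the left. It needs no commutation of `a` and `b`,
  -- since `X` is central in `A[X]`.
  have hs : ∀ n k, (P ^ (n + 1)).coeff (k + 1) = a * (P ^ n).coeff (k + 1) + b * (P ^ n).coeff k := by
    intro n k
    rw [pow_succ', hP, add_mul, Polynomial.coeff_add, Polynomial.coeff_C_mul, mul_assoc,
      Polynomial.coeff_C_mul, Polynomial.coeff_X_mul]
  have hdeg : ∀ n k, n < k → (P ^ n).coeff k = 0 := by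
    intro n
    induction n with
    | zero => intro k hk; simp [Polynomial.coeff_one, hk.ne']
    | succ n ih =>
      intro k hk
      obtain ⟨k, rfl⟩ := Nat.exists_eq_succ_of_ne_zero (by omega : k ≠ 0)
      rw [Nat.succ_eq_add_one, hs, ih _ (by omega), ih _ (by omega)]; simp
  have htop : ∀ n, (P ^ n).coeff n = b ^ n := by
    intro n
    induction n with
    | zero => simp
    | succ n ih => rw [hs, ih, hdeg _ _ (by omega), pow_succ']; simp
  induction i generalizing j with
  | zero => simp [htop]
  | succ i ihi =>
    induction j with
    | zero => simp [hz]
    | succ j ihj =>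
      have h1 := mul_mem_filGT_right H.mul_mem ha (ihi (j + 1))
      have h2 := mul_mem_filGT_right H.mul_mem hb ihj
      have h3 := mul_mem_filGT_left H.mul_mem (hcomm (i + 1)) (hpow hb j)
      have hch : (i + 1 + (j + 1)).choose (j + 1) =
          (i + 1 + j).choose j + (i + (j + 1)).choose (j + 1) := by
        rw [show i + 1 + (j + 1) = (i + 1 + j) + 1 by ring, Nat.choose_succ_succ,
          show i + 1 + j = i + (j + 1) by ring]
      -- Pascal's rule applied to both terms; the last summand is the cost of moving the new `b`
      -- past `a ^ (i + 1)`.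
      have e : (P ^ (i + 1 + (j + 1))).coeff (j + 1) -
          (i + 1 + (j + 1)).choose (j + 1) • (a ^ (i + 1) * b ^ (j + 1)) =
          a * ((P ^ (i + (j + 1))).coeff (j + 1) -
            (i + (j + 1)).choose (j + 1) • (a ^ i * b ^ (j + 1))) +
          b * ((P ^ (i + 1 + j)).coeff j - (i + 1 + j).choose j • (a ^ (i + 1) * b ^ j)) +
          (i + 1 + j).choose j • ((b * a ^ (i + 1) - a ^ (i + 1) * b) * b ^ j) := by
        rw [hch, show i + 1 + (j + 1) = (i + (j + 1)) + 1 by ring, hs,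
          show i + 1 + j = i + (j + 1) by ring, mul_sub, mul_sub, mul_smul_comm, mul_smul_comm,
          add_smul, sub_mul, smul_sub, ← mul_assoc a, ← pow_succ', ← mul_assoc b, mul_assoc _ b,
          ← pow_succ']
        abel
      rw [e]
      refine add_mem (add_mem ?_ ?_) (nsmul_mem ?_ _)
      · convert h1 using 2
        rw [succ_nsmul]; abel
      · convert h2 using 2
        rw [succ_nsmul _ j]; abel
      · convert h3 using 2
        rw [succ_nsmul _ j]; abel

/-- An element commutes, up to terms of higher value, with every element whose value is congruent to
a multiple of its own value. -/
theorem commutator_mem_of_class_eq_nsmul {G : Type*} [AddCommGroup G] {π : Γ →+ G} {cl : κ → G}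
    (hcl : Function.Injective cl) (hp : ∀ g : G, p • g = 0) (hπ : ∀ g, π (ω g) = cl g)
    {γ δ : Γ} {a b : A} (ha : HasValue v p B ω a γ) (hb : HasValue v p B ω b δ) (k : ℕ)
    (hk : π δ = k • π γ) : b * a - a * b ∈ filGT v p B ω (γ + δ) := by
  obtain ⟨g, c, hc, -, hg, hg'⟩ := H.exists_leading_term (H.hasValue_pow ha k)
  obtain ⟨h, d, hd, -, hh, hh'⟩ := H.exists_leading_term hb
  have hgh : g = h := by
    apply hcl
    rw [← hπ, ← hπ]
    have e1 := congrArg π hg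
    have e2 := congrArg π hh
    simp only [map_add, map_nsmul, hp, zero_add] at e1 e2
    rw [e1, e2, hk]
  subst hgh
  -- `b` and `a ^ k` have the same leading monomial, so up to higher terms `b` is a scalar multiple
  -- of `a ^ k`, which commutes with `a`.
  have hb' : b - (d * c⁻¹) • a ^ k ∈ filGT v p B ω δ := by
    have h1 := smul_mem_filGT hg' (mul_ne_zero hd (inv_ne_zero hc))
    have h2 : p • v.val (d * c⁻¹) + k • γ = δ := by
      rw [v.map_mul _ _ hd (inv_ne_zero hc), v.val_inv hc, ← hg, ← hh, smul_add, smul_neg]; abel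
    rw [h2] at h1
    convert sub_mem hh' h1 using 1
    rw [smul_sub, smul_smul, inv_mul_cancel_right₀ hc]; abel
  have e : b * a - a * b = (b - (d * c⁻¹) • a ^ k) * a - a * (b - (d * c⁻¹) • a ^ k) := by
    rw [sub_mul, mul_sub, smul_mul_assoc, mul_smul_comm, ← pow_succ, ← pow_succ']; abel
  rw [e]
  refine sub_mem ?_ (mul_mem_filGT_right H.mul_mem ha.1 hb')
  rw [add_comm]
  exact mul_mem_filGT_left H.mul_mem hb' ha.1

end IsGradedUnitBasis

end Filtration

/-! ### Arithmetic below `p` and lines over the prime field -/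

theorem Nat.cast_choose_ne_zero {F : Type*} [Field F] {p : ℕ}
    (hF : ∀ k : ℕ, 0 < k → k < p → (k : F) ≠ 0) {n j : ℕ} (hn : n < p) (hj : j ≤ n) :
    ((n.choose j : ℕ) : F) ≠ 0 := by
  have hfac : ∀ n < p, ((n.factorial : ℕ) : F) ≠ 0 := by
    intro n
    induction n with
    | zero => simp
    | succ n ih =>
      intro h
      rw [Nat.factorial_succ, Nat.cast_mul]
      exact mul_ne_zero (hF _ (by omega) h) (ih (by omega))
  intro h
  apply hfac n hn
  rw [← Nat.choose_mul_factorial_mul_factorial hj]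
  simp [h]

/-- A polynomial of degree less than `p` over a field of characteristic zero or at least `p` is
determined by its values. -/
theorem Polynomial.eq_zero_of_forall_eval_eq_zero {F : Type*} [Field F] {p : ℕ}
    (hF : ∀ k : ℕ, 0 < k → k < p → (k : F) ≠ 0) (f : Polynomial F) (hdeg : f.degree < p)
    (h : ∀ c, f.eval c = 0) : f = 0 := by
  classical
  refine Polynomial.eq_zero_of_degree_lt_of_eval_index_eq_zero (s := Finset.range p)
    (v := fun n : ℕ => (n : F)) ?_ (by simpa using hdeg) (fun _ _ => h _)
  have key : ∀ a b : ℕ, a < b → b < p → (a : F) ≠ b := by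
    intro a b hab hb heq
    refine hF (b - a) (by omega) (by omega) ?_
    rw [Nat.cast_sub hab.le, heq, sub_self]
  intro a ha b hb heq
  simp only [Finset.coe_range, Set.mem_Iio] at ha hb
  rcases lt_trichotomy a b with h | h | h
  · exact absurd heq (key a b h hb)
  · exact h
  · exact absurd heq.symm (key b a h ha)

theorem ZMod.exists_nat_affine_combination {p : ℕ} [Fact p.Prime] {G : Type*} [AddCommGroup G]
    [Module (ZMod p) G] {e s t : G} {k : ZMod p} (hk : t - e = k • (s - e)) (hst : s ≠ t) :
    ∃ i j : ℕ, i + j = p - 1 ∧ i • s + j • t = (p - 1) • e := by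
  have hp : p.Prime := Fact.out
  have hk1 : 1 - k ≠ 0 := by
    intro h
    have : k = 1 := (sub_eq_zero.1 h).symm
    rw [this, one_smul, sub_left_inj] at hk
    exact hst hk.symm
  -- With `i ≡ z` and `j ≡ -1 - z`, the requirement `i • (s - e) + j • (t - e) = 0` reads `z + (-1 -
  -- z) * k = 0`; `k ≠ 1` because `s ≠ t`.
  set z : ZMod p := k / (1 - k) with hz
  have hlt := z.val_lt
  have hp1 := hp.one_lt
  refine ⟨z.val, p - 1 - z.val, by omega, ?_⟩
  have hc1 : ((z.val : ℕ) : ZMod p) = z := ZMod.natCast_zmod_val z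
  have hc2 : ((p - 1 : ℕ) : ZMod p) = -1 := by
    rw [Nat.cast_sub hp1.le]; simp
  have hc3 : ((p - 1 - z.val : ℕ) : ZMod p) = -1 - z := by
    rw [Nat.cast_sub (by omega), hc1, hc2]
  rw [← Nat.cast_smul_eq_nsmul (ZMod p), ← Nat.cast_smul_eq_nsmul (ZMod p),
    ← Nat.cast_smul_eq_nsmul (ZMod p), hc1, hc2, hc3]
  have ht : t = e + k • (s - e) := by rw [← hk]; abel
  have hzk : z + (-1 - z) * k = 0 := by
    rw [hz]; field_simp; ring
  have h2 : (z + (-1 - z) * k) • (s - e) = 0 := by rw [hzk, zero_smul]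
  rw [ht, ← sub_eq_zero, ← h2]
  module

/-! ### The dimension bound by counting lines -/

section RankBound

open LinearAlgebra.Projectivization in
theorem IsGradedUnitBasis.rank_le {F : Type*} [Field F] {Γ : Type*} [AddCommGroup Γ] [LinearOrder Γ]
    [IsOrderedAddMonoid Γ] {v : OrdVal F Γ} {p : ℕ} [Fact p.Prime]
    {A : Type*} [Ring A] [Algebra F A] {κ : Type*} [Finite κ] {B : Module.Basis κ F A} {ω : κ → Γ}
    (H : IsGradedUnitBasis v p B ω)
    {G : Type*} [AddCommGroup G] [Module (ZMod p) G] [Finite G] {π : Γ →+ G} {cl : κ → G}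
    (hcl : Function.Injective cl) (hπ : ∀ g, π (ω g) = cl g)
    (hF : ∀ k : ℕ, 0 < k → k < p → (k : F) ≠ 0)
    (hval : ∀ k : ℕ, (k : F) ≠ 0 → v.val (k : F) = 0)
    (T : A →ₗ[F] F) (τ : F) (hτ : τ ≠ 0) (g₀ : κ) (hT : ∀ a, T a = τ * B.repr a g₀)
    (e : G) (he : cl g₀ = (p - 1) • e)
    (hcomm : ∀ a b γ δ, HasValue v p B ω a γ → HasValue v p B ω b δ → ∀ k : ZMod p,
      π δ - e = k • (π γ - e) → b * a - a * b ∈ filGT v p B ω (γ + δ))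
    (V : Submodule F A) (hV : ∀ a ∈ V, T (a ^ (p - 1)) = 0) :
    Module.rank F V ≤ (Nat.card (ℙ (ZMod p) G) : Cardinal) := by
  classical
  have := Fintype.ofFinite κ
  have hp : p.Prime := Fact.out
  have hpG : ∀ g : G, p • g = 0 := fun g => by
    rw [← Nat.cast_smul_eq_nsmul (ZMod p)]; simp
  have hclass : ∀ a γ, HasValue v p B ω a γ → ∃ g, B.repr a g ≠ 0 ∧ cl g = π γ := by
    intro a γ ha
    obtain ⟨g, hg, hg'⟩ := exists_repr_of_notMem_filGT ha.1 ha.2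
    refine ⟨g, hg, ?_⟩
    rw [← hg', map_add, map_nsmul, hpG, zero_add, hπ]
  have hTne : ∀ a γ, HasValue v p B ω a γ → π γ = (p - 1) • e → T a ≠ 0 := by
    intro a γ ha hγ
    obtain ⟨g, hg, hg'⟩ := hclass a γ ha
    have : g = g₀ := hcl (by rw [hg', hγ, he])
    rw [hT, ← this]
    exact mul_ne_zero hτ hg
  -- The leading monomials of elements of `V`.
  set S : Set κ := {g | ∃ a ∈ V, ∃ γ, HasValue v p B ω a γ ∧ cl g = π γ} with hS
  have hne : ∀ g ∈ S, cl g - e ≠ 0 := by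
    rintro g ⟨a, haV, γ, ha, hg⟩ h0
    refine hTne _ _ (H.hasValue_pow ha (p - 1)) ?_ (hV a haV)
    rw [map_nsmul, ← hg, sub_eq_zero.1 h0]
  have hline : ∀ g ∈ S, ∀ h ∈ S, ∀ k : ZMod p, cl h - e = k • (cl g - e) → g = h := by
    rintro g ⟨a, haV, γ, ha, hg⟩ h ⟨b, hbV, δ, hb, hh⟩ k hk
    by_contra hgh
    obtain ⟨i, j, hij, hsum⟩ := ZMod.exists_nat_affine_combination hk (hcl.ne hgh)
    rw [hg, hh] at hk
    have hab := hcomm a b γ δ ha hb k hk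
    have hco := H.coeff_add_pow_sub_mem ha.1 hb.1 hab i j
    have hch := Nat.cast_choose_ne_zero hF (show i + j < p by have := hp.pos; omega)
      (Nat.le_add_left j i)
    have hv1 : HasValue v p B ω ((i + j).choose j • (a ^ i * b ^ j)) (i • γ + j • δ) := by
      have := (H.hasValue_mul (H.hasValue_pow ha i) (H.hasValue_pow hb j)).smul hch
      rw [hval _ hch, smul_zero, zero_add, Nat.cast_smul_eq_nsmul] at this
      exact this
    have hv2 := hv1.add hco
    rw [add_sub_cancel] at hv2
    refine hTne _ _ hv2 (by rw [map_add, map_nsmul, map_nsmul, ← hg, ← hh, hsum]) ?_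
    rw [hij]
    -- `P` keeps the powers of the scalar `c` formal, and `f` applies the trace to each coefficient,
    -- so that `f.eval c` is the trace of `(a + c • b) ^ (p - 1)`.
    set P := (Polynomial.C a + Polynomial.C b * Polynomial.X) ^ (p - 1) with hP
    have hPdeg : P.natDegree < p := by
      refine lt_of_le_of_lt (Polynomial.natDegree_pow_le_of_le (p - 1) (m := 1) ?_)
        (by have := hp.pos; omega)
      refine (Polynomial.natDegree_add_le _ _).trans (max_le (by simp) ?_)
      exact (Polynomial.natDegree_C_mul_le _ _).trans Polynomial.natDegree_X_le
    set f : Polynomial F := ∑ n ∈ Finset.range p, Polynomial.monomial n (T (P.coeff n)) with hf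
    have hcoeff : ∀ n, n < p → f.coeff n = T (P.coeff n) := by
      intro n hn
      simp [hf, Polynomial.finsetSum_coeff, Polynomial.coeff_monomial, hn]
    have hf0 : f = 0 := by
      refine Polynomial.eq_zero_of_forall_eval_eq_zero hF f ?_ ?_
      · rw [Polynomial.degree_lt_iff_coeff_zero]
        intro n hn
        simp [hf, Polynomial.finsetSum_coeff, Polynomial.coeff_monomial, hn]
      · intro c
        rw [← hV (a + c • b) (add_mem haV (V.smul_mem c hbV))]
        have e1 : (a + c • b) ^ (p - 1) = P.eval (algebraMap F A c) := by
          have hcm : ∀ x : A, Commute x (algebraMap F A c) := fun x => (Algebra.commutes c x).symm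
          let φ : Polynomial A →+* A := Polynomial.eval₂RingHom' (RingHom.id A) (algebraMap F A c)
            (fun x => hcm x)
          have : P.eval (algebraMap F A c) = φ P := rfl
          rw [this, hP, map_pow]
          congr 1
          simp [φ, Polynomial.eval₂RingHom', Algebra.smul_def, Algebra.commutes]
        rw [e1, Polynomial.eval_eq_sum_range' hPdeg, map_sum, hf, Polynomial.eval_finsetSum]
        refine Finset.sum_congr rfl fun n _ => ?_
        rw [Polynomial.eval_monomial, ← map_pow, ← Algebra.commutes, ← Algebra.smul_def, map_smul,
          smul_eq_mul, mul_comm]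
    rw [← hcoeff j (by have := hp.pos; omega), hf0, Polynomial.coeff_zero]
  have hcard : Nat.card S ≤ Nat.card (ℙ (ZMod p) G) := by
    refine Nat.card_le_card_of_injective
      (fun g : S => Projectivization.mk (ZMod p) (cl g - e) (hne g g.2)) ?_
    intro g h hgh
    rw [Projectivization.mk_eq_mk_iff'] at hgh
    obtain ⟨k, hk⟩ := hgh
    exact Subtype.ext (hline h h.2 g g.2 k hk.symm).symm
  -- Reading off the coordinates in `S` is injective on `V`: the leading coordinate of a nonzero
  -- element of `V` lies in `S` and is not zero.
  let L : V →ₗ[F] (S → F) :=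
    (LinearMap.pi fun g : S => B.coord g).comp V.subtype
  have hL : Function.Injective L := by
    rw [← LinearMap.ker_eq_bot, LinearMap.ker_eq_bot']
    intro a ha
    by_contra h0
    have h0' : (a : A) ≠ 0 := by simpa using h0
    obtain ⟨γ, hγ⟩ := exists_mem_filGE_notMem_filGT (v := v) (p := p) (B := B) (ω := ω) h0'
    obtain ⟨g, hg, hg'⟩ := hclass _ _ hγ
    exact hg (congrFun ha ⟨g, a, a.2, γ, hγ, hg'⟩)
  have : Module.Finite F A := Module.Finite.of_basis B
  have h1 := LinearMap.finrank_le_finrank_of_injective hL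
  rw [Module.finrank_fintype_fun_eq_card, ← Nat.card_eq_fintype_card] at h1
  rw [← Module.finrank_eq_rank]
  exact_mod_cast h1.trans hcard

end RankBound

/-! ### Symbol algebras: monomial basis and splitting -/

/-- `x` and `y` generate `Q` and satisfy `x ^ p = α + ε x`, `y ^ p = β`, `y x = (ρ x + ε) y`. With
`ε = 0` these are the relations of `(α, β)_{p,F}`, with `ρ = ε = 1` those of `[α, β)_{p,F}`. -/
structure SymbolGens {F : Type*} [Field F] (p : ℕ) (ρ ε α β : F) {Q : Type*} [Ring Q] [Algebra F Q]
    (x y : Q) : Prop where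
  x_pow : x ^ p = algebraMap F Q α + ε • x
  y_pow : y ^ p = algebraMap F Q β
  comm : y * x = (ρ • x + ε • 1) * y
  adjoin : Algebra.adjoin F {x, y} = ⊤

/-- The representation of a symbol algebra by `p × p` matrices over `K`: `x` acts by a diagonal matrix
with distinct entries, `y` by a multiple of a cyclic permutation. -/
structure SymbolRep {F : Type*} [Field F] (p : ℕ) {Q : Type*} [Ring Q] [Algebra F Q]
    (x y : Q) {K : Type*} [Field K] [Algebra F K] [NeZero p]
    (φ : Q →ₐ[F] Matrix (ZMod p) (ZMod p) K) (d : ZMod p → K) (b : K) : Prop where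
  map_x : φ x = Matrix.diagonal d
  map_y : φ y = b • Matrix.of fun i j : ZMod p => if j = i + 1 then 1 else 0
  inj : Function.Injective d
  ne_zero : b ≠ 0

theorem Matrix.cyclicShift_pow (p : ℕ) [NeZero p] (K : Type*) [Semiring K] (n : ℕ) :
    (Matrix.of fun i j : ZMod p => if j = i + 1 then (1 : K) else 0) ^ n =
      Matrix.of fun i j : ZMod p => if j = i + n then (1 : K) else 0 := by
  induction n with
  | zero => ext i j; simp [Matrix.one_apply, eq_comm]
  | succ n ih =>
    ext i j
    rw [pow_succ, ih, Matrix.mul_apply]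
    simp only [Matrix.of_apply, ite_mul, one_mul, zero_mul, Finset.sum_ite_eq',
      Finset.mem_univ, if_true, add_assoc, Nat.cast_succ]

/-- Lagrange interpolation at the distinct diagonal entries produces the diagonal matrix units, and
multiplying these by powers of the cyclic shift gives all the others. -/
theorem Matrix.subalgebra_eq_top_of_diagonal_mem {p : ℕ} [NeZero p] {K : Type*} [Field K]
    {d : ZMod p → K} (hd : Function.Injective d) {b : K} (hb : b ≠ 0)
    (S : Subalgebra K (Matrix (ZMod p) (ZMod p) K)) (h1 : Matrix.diagonal d ∈ S)
    (h2 : (b • Matrix.of fun i j : ZMod p => if j = i + 1 then (1 : K) else 0) ∈ S) : S = ⊤ := by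
  classical
  set s : Matrix (ZMod p) (ZMod p) K := Matrix.of fun i j => if j = i + 1 then 1 else 0 with hs
  have hsS : s ∈ S := by
    have := S.smul_mem h2 b⁻¹
    rwa [inv_smul_smul₀ hb] at this
  have hdiag : ∀ k, Matrix.single k k (1 : K) ∈ S := by
    intro k
    have h3 : Polynomial.aeval (Matrix.diagonal d) (Lagrange.basis Finset.univ d k) ∈ S :=
      Algebra.adjoin_le (by simpa using h1) (Polynomial.aeval_mem_adjoin_singleton K _)
    convert h3 using 1
    have e : Matrix.diagonal d = Matrix.diagonalAlgHom K d := rfl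
    rw [e, Polynomial.aeval_algHom_apply]
    change _ = Matrix.diagonal _
    rw [← Matrix.diagonal_single]
    congr 1
    ext l
    rw [Polynomial.aeval_fn_apply, Polynomial.aeval_def, Algebra.algebraMap_self,
      Polynomial.eval₂_id]
    by_cases hl : k = l
    · subst hl
      rw [Lagrange.eval_basis_self (hd.injOn) (Finset.mem_univ _)]
      simp
    · rw [Lagrange.eval_basis_of_ne hl (Finset.mem_univ _)]
      simp [hl]
  rw [eq_top_iff]
  rintro M -
  rw [Matrix.matrix_eq_sum_single M]
  refine sum_mem fun i _ => sum_mem fun j _ => ?_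
  have e : Matrix.single i j (M i j) = M i j • (Matrix.single i i 1 * s ^ (j - i).val) := by
    ext k l
    rw [Matrix.smul_apply, hs, Matrix.cyclicShift_pow]
    by_cases hk : i = k
    · subst hk
      rw [Matrix.single_mul_apply_same]
      simp [Matrix.single_apply, eq_comm]
    · simp [hk, Matrix.mul_apply]
  rw [e]
  exact S.smul_mem (S.mul_mem (hdiag i) (S.pow_mem hsS _)) _

section Factor

variable {F : Type*} [Field F] {p : ℕ} {ρ ε α β : F} {Q : Type*} [Ring Q] [Algebra F Q]
  {x y : Q} (D : SymbolGens p ρ ε α β x y)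
include D

theorem SymbolGens.y_mul_x_pow_mul (j : ℕ) (a : Q) :
    y * (x ^ j * a) = (ρ • x + ε • 1) ^ j * (y * a) := by
  induction j generalizing a with
  | zero => simp
  | succ j ih =>
    rw [pow_succ, mul_assoc, ih, ← mul_assoc y x, D.comm, pow_succ]
    simp only [mul_assoc]

/-- The span contains `1` and is stable under left multiplication by both generators. -/
theorem SymbolGens.span_eq_top (hp : 1 < p) :
    Submodule.span F (Set.range fun g : Fin p × Fin p => x ^ (g.1 : ℕ) * y ^ (g.2 : ℕ)) = ⊤ := by
  set W := Submodule.span F (Set.range fun g : Fin p × Fin p => x ^ (g.1 : ℕ) * y ^ (g.2 : ℕ))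
    with hW
  have hmem : ∀ j k : ℕ, j < p → k < p → x ^ j * y ^ k ∈ W := fun j k hj hk =>
    Submodule.subset_span ⟨(⟨j, hj⟩, ⟨k, hk⟩), rfl⟩
  have hx : ∀ a ∈ W, x * a ∈ W := by
    intro a ha
    induction ha using Submodule.span_induction with
    | mem a ha =>
      obtain ⟨⟨⟨j, hj⟩, ⟨k, hk⟩⟩, rfl⟩ := ha
      dsimp only
      rw [← mul_assoc, ← pow_succ']
      rcases Nat.lt_or_ge (j + 1) p with h | h
      · exact hmem _ _ h hk
      · rw [show j + 1 = p by omega, D.x_pow, add_mul, Algebra.algebraMap_eq_smul_one,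
          smul_mul_assoc, smul_mul_assoc]
        refine add_mem (W.smul_mem _ ?_) (W.smul_mem _ ?_)
        · simpa using hmem 0 k (by omega) hk
        · simpa using hmem 1 k hp hk
    | zero => simp
    | add a b _ _ ha hb => rw [mul_add]; exact add_mem ha hb
    | smul c a _ ha => rw [mul_smul_comm]; exact W.smul_mem _ ha
  have hxe : ∀ j : ℕ, ∀ a ∈ W, (ρ • x + ε • 1) ^ j * a ∈ W := by
    intro j
    induction j with
    | zero => simp
    | succ j ih =>
      intro a ha
      rw [pow_succ, mul_assoc]
      refine ih _ ?_
      rw [add_mul, smul_mul_assoc, smul_mul_assoc, one_mul]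
      exact add_mem (W.smul_mem _ (hx a ha)) (W.smul_mem _ ha)
  have hy : ∀ a ∈ W, y * a ∈ W := by
    intro a ha
    induction ha using Submodule.span_induction with
    | mem a ha =>
      obtain ⟨⟨⟨j, hj⟩, ⟨k, hk⟩⟩, rfl⟩ := ha
      dsimp only
      rw [D.y_mul_x_pow_mul, ← pow_succ']
      refine hxe _ _ ?_
      rcases Nat.lt_or_ge (k + 1) p with h | h
      · simpa using hmem 0 _ (by omega) h
      · rw [show k + 1 = p by omega, D.y_pow, Algebra.algebraMap_eq_smul_one]
        refine W.smul_mem _ ?_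
        simpa using hmem 0 0 (by omega) (by omega)
    | zero => simp
    | add a b _ _ ha hb => rw [mul_add]; exact add_mem ha hb
    | smul c a _ ha => rw [mul_smul_comm]; exact W.smul_mem _ ha
  have hall : ∀ q : Q, ∀ a ∈ W, q * a ∈ W := by
    intro q
    have hq : q ∈ Algebra.adjoin F {x, y} := D.adjoin ▸ Algebra.mem_top
    induction hq using Algebra.adjoin_induction with
    | mem q hq =>
      rcases hq with rfl | rfl
      · exact hx
      · exact hy
    | algebraMap r => intro a ha; rw [← Algebra.smul_def]; exact W.smul_mem _ ha
    | add q r _ _ hq hr => intro a ha; rw [add_mul]; exact add_mem (hq a ha) (hr a ha)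
    | mul q r _ _ hq hr => intro a ha; rw [mul_assoc]; exact hq _ (hr a ha)
  rw [eq_top_iff]
  rintro q -
  simpa using hall q 1 (by simpa using hmem 0 0 (by omega) (by omega))

variable {K : Type*} [Field K] [Algebra F K] [NeZero p]
  {φ : Q →ₐ[F] Matrix (ZMod p) (ZMod p) K} {d : ZMod p → K} {b : K}

/-- The monomials `x ^ j * y ^ k` are a basis of `Q`, and their images a basis of the matrix
algebra. -/
theorem SymbolGens.exists_basis (hp : 1 < p) (R : SymbolRep p x y φ d b) :
    ∃ B : Module.Basis (Fin p × Fin p) F Q, (∀ g, B g = x ^ (g.1 : ℕ) * y ^ (g.2 : ℕ)) ∧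
      ∃ C : Module.Basis (Fin p × Fin p) K (Matrix (ZMod p) (ZMod p) K), ∀ g, C g = φ (B g) := by
  have hspan := D.span_eq_top hp
  have hfin : Module.Finite F Q := by
    rw [Module.finite_def, ← hspan]
    exact Submodule.fg_span (Set.finite_range _)
  let Φ : K ⊗[F] Q →ₐ[K] Matrix (ZMod p) (ZMod p) K :=
    Algebra.TensorProduct.lift (Algebra.ofId K _) φ fun _ _ => Algebra.commutes _ _
  have hΦ : ∀ q, Φ (1 ⊗ₜ q) = φ q := by 
    intro q
    exact (Algebra.TensorProduct.lift_tmul _ _ _ _ _).trans (by simp)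
  have hrange : Φ.range = ⊤ := Matrix.subalgebra_eq_top_of_diagonal_mem R.inj R.ne_zero _
    ⟨1 ⊗ₜ x, by rw [← R.map_x]; exact hΦ x⟩ ⟨1 ⊗ₜ y, by rw [← R.map_y]; exact hΦ y⟩
  have hsurj : Function.Surjective Φ := by
    intro M
    have : M ∈ Φ.range := hrange ▸ Algebra.mem_top
    exact this
  have hM : Module.finrank K (Matrix (ZMod p) (ZMod p) K) = p * p := by
    rw [Module.finrank_matrix]; simp [ZMod.card]
  -- The surjection onto `p × p` matrices gives the lower bound, the spanning monomials the upper
  -- one; equality makes the monomials a basis and the surjection an isomorphism.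
  have h1 : p * p ≤ Module.finrank F Q := by
    have := LinearMap.finrank_le_finrank_of_surjective (f := Φ.toLinearMap) hsurj
    rwa [hM, Module.finrank_baseChange] at this
  have h2 : Module.finrank F Q ≤ p * p := by
    rw [← finrank_top F Q, ← hspan]
    refine (finrank_range_le_card _).trans ?_
    simp
  have h3 : Module.finrank F Q = p * p := le_antisymm h2 h1
  let B := basisOfTopLeSpanOfCardEqFinrank
    (fun g : Fin p × Fin p => x ^ (g.1 : ℕ) * y ^ (g.2 : ℕ)) hspan.ge (by simp [h3])
  have hB : ∀ g, B g = x ^ (g.1 : ℕ) * y ^ (g.2 : ℕ) := fun g => by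
    simp [B]
  have hbij : Function.Bijective Φ.toLinearMap := by
    refine ⟨?_, hsurj⟩
    rw [LinearMap.injective_iff_surjective_of_finrank_eq_finrank]
    · exact hsurj
    · rw [hM, Module.finrank_baseChange, h3]
  refine ⟨B, hB, (Algebra.TensorProduct.basis K B).map (LinearEquiv.ofBijective _ hbij), ?_⟩
  intro g
  simp [hΦ]

omit D in
theorem SymbolRep.trace_map (R : SymbolRep p x y φ d b) (j k : ℕ) (hk : k < p) :
    (φ (x ^ j * y ^ k)).trace = if k = 0 then ∑ t, d t ^ j else 0 := by
  rw [map_mul, map_pow, map_pow, R.map_x, R.map_y, smul_pow, Matrix.cyclicShift_pow, Matrix.diagonal_pow,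
    mul_smul_comm, Matrix.trace_smul]
  have hk0 : (k : ZMod p) = 0 ↔ k = 0 := by
    rw [ZMod.natCast_eq_zero_iff]
    exact ⟨fun h => Nat.eq_zero_of_dvd_of_lt h hk, fun h => h ▸ dvd_zero p⟩
  split_ifs with h
  · simp [h, Matrix.trace, Matrix.diagonal_mul]
  · simp [Matrix.trace, Matrix.diagonal_mul, hk0, h]

end Factor

/-! ### The filtration on one symbol algebra -/

section FactorValue

variable {F : Type*} [Field F] {Γ : Type*} [AddCommGroup Γ] [LinearOrder Γ]
  [IsOrderedAddMonoid Γ] {v : OrdVal F Γ} {p : ℕ} {ρ ε α β : F} {Q : Type*} [Ring Q] [Algebra F Q]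
  {x y : Q}

variable (v α β) in
/-- The value of `x ^ j * y ^ k`. -/
def symbolWeight (g : Fin p × Fin p) : Γ := (g.1 : ℕ) • v.val α + (g.2 : ℕ) • v.val β

variable (D : SymbolGens p ρ ε α β x y) (hp : 1 < p) (hα : α ≠ 0) (hβ : β ≠ 0)
  (hvα : v.val α < 0) (hvρ : v.val ρ = 0) (hvε : ε ≠ 0 → v.val ε = 0)
  {B : Module.Basis (Fin p × Fin p) F Q} (hB : ∀ g, B g = x ^ (g.1 : ℕ) * y ^ (g.2 : ℕ))
include D hp hα hβ hvα hvρ hvε hB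

/-- Only the reductions of `x ^ p`, `y ^ p` and `y * x` need checking. The scalars `α`, `β` have
exactly the values of `x ^ p`, `y ^ p`, and the extra terms from `ε` do not lower the value because
`v α < 0`. -/
theorem SymbolGens.generator_mul_mem_filGE :
    (∀ j k : ℕ, j < p → k < p →
      x ^ j * y ^ k ∈ filGE v p B (symbolWeight v α β) (j • v.val α + k • v.val β)) ∧
    (∀ δ, ∀ a ∈ filGE v p B (symbolWeight v α β) δ,
      x * a ∈ filGE v p B (symbolWeight v α β) (v.val α + δ)) ∧
    (∀ δ, ∀ a ∈ filGE v p B (symbolWeight v α β) δ,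
      y * a ∈ filGE v p B (symbolWeight v α β) (v.val β + δ)) := by
  set ω := symbolWeight (p := p) v α β with hω
  have hmon : ∀ j k : ℕ, j < p → k < p → x ^ j * y ^ k ∈ filGE v p B ω (j • v.val α + k • v.val β) := by
    intro j k hj hk
    have := basis_mem_filGE (v := v) (p := p) (B := B) (ω := ω) (⟨j, hj⟩, ⟨k, hk⟩)
    rwa [hB] at this
  have hscal : ∀ {c : F} {a : Q} {δ : Γ}, (c ≠ 0 → v.val c = 0) → a ∈ filGE v p B ω δ →
      c • a ∈ filGE v p B ω δ := by
    intro c a δ hc ha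
    by_cases h0 : c = 0
    · simp [h0]
    · simpa [hc h0] using smul_mem_filGE ha h0
  have hext : ∀ (z : Q) (γ : Γ), (∀ g, z * B g ∈ filGE v p B ω (γ + ω g)) →
      ∀ δ, ∀ a ∈ filGE v p B ω δ, z * a ∈ filGE v p B ω (γ + δ) := by
    intro z γ hz δ a ha
    rw [← B.sum_repr a, Finset.mul_sum]
    refine sum_mem fun g _ => ?_
    by_cases h0 : B.repr a g = 0
    · simp [h0]
    rw [mul_smul_comm]
    refine filGE_anti ?_ (smul_mem_filGE (hz g) h0)
    rw [add_left_comm]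
    gcongr
    exact ha g h0
  have hx : ∀ δ, ∀ a ∈ filGE v p B ω δ, x * a ∈ filGE v p B ω (v.val α + δ) := by
    refine hext x _ ?_
    rintro ⟨⟨j, hj⟩, ⟨k, hk⟩⟩
    rw [hB, ← mul_assoc, ← pow_succ']
    rcases Nat.lt_or_ge (j + 1) p with h | h
    · convert hmon _ _ h hk using 2
      simp only [hω, symbolWeight, succ_nsmul]; abel
    · have hj' : j + 1 = p := by omega
      have hwt : v.val α + ω (⟨j, hj⟩, ⟨k, hk⟩) = p • v.val α + k • v.val β := by
        have : p • v.val α = j • v.val α + v.val α := by rw [← succ_nsmul, hj']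
        simp only [hω, symbolWeight, this]; abel
      rw [hwt]
      simp only [hj', D.x_pow, add_mul, Algebra.algebraMap_eq_smul_one, smul_mul_assoc, one_mul]
      refine add_mem ?_ ?_
      · have := smul_mem_filGE (hmon 0 k (by omega) hk) hα
        simpa using this
      -- The term `ε • x` of `x ^ p`: its value is at least `v α`, which is at least `p • v α`
      -- because `v α < 0`.
      · refine hscal hvε (filGE_anti ?_ (by simpa using hmon 1 k hp hk))
        gcongr
        calc p • v.val α ≤ 1 • v.val α := nsmul_le_nsmul_left_of_nonpos hvα.le hp.le
          _ = v.val α := one_nsmul _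
  have hxe : ∀ (j : ℕ) δ, ∀ a ∈ filGE v p B ω δ,
      (ρ • x + ε • 1) ^ j * a ∈ filGE v p B ω (j • v.val α + δ) := by
    intro j
    induction j with
    | zero => simp
    | succ j ih =>
      intro δ a ha
      rw [pow_succ, mul_assoc, succ_nsmul, add_assoc]
      refine ih _ _ ?_
      rw [add_mul, smul_mul_assoc, smul_mul_assoc, one_mul]
      refine add_mem (hscal (fun _ => hvρ) (hx _ _ ha)) (hscal hvε (filGE_anti ?_ ha))
      simpa using hvα.le
  refine ⟨hmon, hx, hext y _ ?_⟩
  rintro ⟨⟨j, hj⟩, ⟨k, hk⟩⟩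
  rw [hB]
  dsimp only
  rw [D.y_mul_x_pow_mul, ← pow_succ']
  have hwt : v.val β + ω (⟨j, hj⟩, ⟨k, hk⟩) = j • v.val α + (k + 1) • v.val β := by
    simp only [hω, symbolWeight, succ_nsmul]; abel
  rw [hwt]
  refine hxe j _ _ ?_
  rcases Nat.lt_or_ge (k + 1) p with h | h
  · simpa using hmon 0 _ (by omega) h
  · rw [show k + 1 = p by omega, D.y_pow, Algebra.algebraMap_eq_smul_one]
    simpa using smul_mem_filGE (hmon 0 0 (by omega) (by omega)) hβ

theorem SymbolGens.basis_mul_mem (g h : Fin p × Fin p) :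
    B g * B h ∈ filGE v p B (symbolWeight v α β) (symbolWeight v α β g + symbolWeight v α β h) := by
  obtain ⟨-, hx, hy⟩ := D.generator_mul_mem_filGE hp hα hβ hvα hvρ hvε hB
  have hxp : ∀ (j : ℕ) δ, ∀ a ∈ filGE v p B (symbolWeight v α β) δ,
      x ^ j * a ∈ filGE v p B (symbolWeight v α β) (j • v.val α + δ) := by
    intro j
    induction j with
    | zero => simp
    | succ j ih =>
      intro δ a ha
      rw [pow_succ, mul_assoc, succ_nsmul, add_assoc]
      exact ih _ _ (hx _ _ ha)
  have hyp : ∀ (j : ℕ) δ, ∀ a ∈ filGE v p B (symbolWeight v α β) δ,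
      y ^ j * a ∈ filGE v p B (symbolWeight v α β) (j • v.val β + δ) := by
    intro j
    induction j with
    | zero => simp
    | succ j ih =>
      intro δ a ha
      rw [pow_succ, mul_assoc, succ_nsmul, add_assoc]
      exact ih _ _ (hy _ _ ha)
  rw [hB g, mul_assoc]
  have := hxp g.1 _ _ (hyp g.2 _ _ (basis_mem_filGE (v := v) (p := p) (B := B)
    (ω := symbolWeight v α β) h))
  convert this using 2
  rw [symbolWeight, add_assoc]

/-- The relations for `x ^ p` and `y ^ p` give the inverses `α⁻¹ (x ^ (p - 1) - ε)` of `x` and `β⁻¹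
y ^ (p - 1)` of `y`, with values opposite to those of `x` and `y`. -/
theorem SymbolGens.basis_exists_inv (g : Fin p × Fin p) :
    ∃ u ∈ filGE v p B (symbolWeight v α β) (-symbolWeight v α β g), u * B g = 1 := by
  obtain ⟨hmon, -, -⟩ := D.generator_mul_mem_filGE hp hα hβ hvα hvρ hvε hB
  have hmul := D.basis_mul_mem hp hα hβ hvα hvρ hvε hB
  have hone : (1 : Q) ∈ filGE v p B (symbolWeight v α β) 0 := by
    simpa using hmon 0 0 (by omega) (by omega)
  obtain ⟨n, rfl⟩ : ∃ n, p = n + 1 := ⟨p - 1, by omega⟩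
  set x' : Q := α⁻¹ • (x ^ n - ε • 1) with hx'
  set y' : Q := β⁻¹ • y ^ n with hy'
  have hxx : x' * x = 1 := by
    rw [hx', smul_mul_assoc, sub_mul, ← pow_succ, D.x_pow, smul_mul_assoc, one_mul,
      add_sub_cancel_right, Algebra.algebraMap_eq_smul_one, inv_smul_smul₀ hα]
  have hyy : y' * y = 1 := by
    rw [hy', smul_mul_assoc, ← pow_succ, D.y_pow, Algebra.algebraMap_eq_smul_one,
      inv_smul_smul₀ hβ]
  have hx'm : x' ∈ filGE v (n + 1) B (symbolWeight v α β) (-v.val α) := by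
    have h1 : x ^ n - ε • 1 ∈ filGE v (n + 1) B (symbolWeight v α β) (n • v.val α) := by
      refine sub_mem (by simpa using hmon n 0 (by omega) (by omega)) ?_
      by_cases h0 : ε = 0
      · simp [h0]
      · refine filGE_anti ?_ (smul_mem_filGE hone h0)
        rw [hvε h0]
        simpa using nsmul_nonpos hvα.le n
    convert smul_mem_filGE h1 (inv_ne_zero hα) using 2
    rw [v.val_inv hα, succ_nsmul, smul_neg]; abel
  have hy'm : y' ∈ filGE v (n + 1) B (symbolWeight v α β) (-v.val β) := by
    have h1 : y ^ n ∈ filGE v (n + 1) B (symbolWeight v α β) (n • v.val β) := by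
      simpa using hmon 0 n (by omega) (by omega)
    convert smul_mem_filGE h1 (inv_ne_zero hβ) using 2
    rw [v.val_inv hβ, succ_nsmul, smul_neg]; abel
  have hinv : ∀ {z' z : Q}, z' * z = 1 → ∀ j : ℕ, z' ^ j * z ^ j = 1 := by
    intro z' z h j
    induction j with
    | zero => simp
    | succ j ih => rw [pow_succ, pow_succ', mul_assoc, ← mul_assoc z', h, one_mul, ih]
  refine ⟨y' ^ (g.2 : ℕ) * x' ^ (g.1 : ℕ), ?_, ?_⟩
  · convert mul_mem_filGE hmul (pow_mem_filGE hmul hone hy'm (g.2 : ℕ))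
      (pow_mem_filGE hmul hone hx'm (g.1 : ℕ)) using 2
    rw [symbolWeight, smul_neg, smul_neg]; abel
  · rw [hB, mul_assoc, ← mul_assoc (x' ^ _), hinv hxx, one_mul, hinv hyy]

/-- For `ρ = 1` the commutator `y x - x y` is `ε y`, of value greater than `v β + v α` because `v α
< 0`; this spreads to all monomials through the Leibniz rule. -/
theorem SymbolGens.basis_commutator_mem (hρ1 : ρ = 1) (g h : Fin p × Fin p) :
    B g * B h - B h * B g ∈
      filGT v p B (symbolWeight v α β) (symbolWeight v α β g + symbolWeight v α β h) := by
  obtain ⟨hmon, -, -⟩ := D.generator_mul_mem_filGE hp hα hβ hvα hvρ hvε hB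
  have hmul := D.basis_mul_mem hp hα hβ hvα hvρ hvε hB
  have hone : (1 : Q) ∈ filGE v p B (symbolWeight v α β) 0 := by
    simpa using hmon 0 0 (by omega) (by omega)
  have hxm : x ∈ filGE v p B (symbolWeight v α β) (v.val α) := by
    simpa using hmon 1 0 hp (by omega)
  have hym : y ∈ filGE v p B (symbolWeight v α β) (v.val β) := by
    simpa using hmon 0 1 (by omega) hp
  have hyx : y * x - x * y ∈ filGT v p B (symbolWeight v α β) (v.val β + v.val α) := by
    rw [D.comm, hρ1, one_smul, add_mul, add_sub_cancel_left, smul_mul_assoc, one_mul]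
    by_cases h0 : ε = 0
    · simp [h0]
    · refine filGE_le_filGT ?_ (smul_mem_filGE hym h0)
      rw [hvε h0]
      simpa using hvα
  have hpow : ∀ {z w : Q} {γ δ : Γ}, z ∈ filGE v p B (symbolWeight v α β) γ →
      w ∈ filGE v p B (symbolWeight v α β) δ →
      z * w - w * z ∈ filGT v p B (symbolWeight v α β) (γ + δ) → ∀ n : ℕ,
      z ^ n * w - w * z ^ n ∈ filGT v p B (symbolWeight v α β) (n • γ + δ) := by
    intro z w γ δ hz hw hzw n
    induction n with
    | zero => simp
    | succ n ih =>
      have e : z ^ (n + 1) * w - w * z ^ (n + 1) =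
          z ^ n * (z * w - w * z) + (z ^ n * w - w * z ^ n) * z := by
        rw [pow_succ]; noncomm_ring
      rw [e]
      refine add_mem ?_ ?_
      · convert mul_mem_filGT_right hmul (pow_mem_filGE hmul hone hz n) hzw using 2
        rw [succ_nsmul]; abel
      · convert mul_mem_filGT_left hmul ih hz using 2
        rw [succ_nsmul]; abel
  have hneg : ∀ {z w : Q} {γ : Γ}, z * w - w * z ∈ filGT v p B (symbolWeight v α β) γ →
      w * z - z * w ∈ filGT v p B (symbolWeight v α β) γ := by
    intro z w γ h
    simpa using neg_mem h
  have hxpow := pow_mem_filGE hmul hone hxm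
  have hypow := pow_mem_filGE hmul hone hym
  have hyxp : ∀ j k : ℕ, y ^ k * x ^ j - x ^ j * y ^ k ∈
      filGT v p B (symbolWeight v α β) (k • v.val β + j • v.val α) := by
    intro j k
    refine hneg ?_
    rw [add_comm]
    refine hpow hxm (hypow k) (hneg ?_) j
    rw [add_comm]
    exact hpow hym hxm hyx k
  rw [hB, hB, symbolWeight, symbolWeight]
  obtain ⟨⟨j, hj⟩, ⟨k, hk⟩⟩ := g
  obtain ⟨⟨j', hj'⟩, ⟨k', hk'⟩⟩ := h
  dsimp only
  have e : x ^ j * y ^ k * (x ^ j' * y ^ k') - x ^ j' * y ^ k' * (x ^ j * y ^ k) =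
      x ^ j * (y ^ k * x ^ j' - x ^ j' * y ^ k) * y ^ k' -
      x ^ j' * (y ^ k' * x ^ j - x ^ j * y ^ k') * y ^ k := by
    have e1 : x ^ j * x ^ j' = x ^ j' * x ^ j := by rw [← pow_add, ← pow_add, add_comm]
    have e2 : y ^ k * y ^ k' = y ^ k' * y ^ k := by rw [← pow_add, ← pow_add, add_comm]
    have e3 : x ^ j * (x ^ j' * y ^ k) * y ^ k' = x ^ j' * (x ^ j * y ^ k') * y ^ k := by
      rw [← mul_assoc, e1, mul_assoc, mul_assoc, mul_assoc, e2]
      simp only [mul_assoc]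
    rw [mul_sub, mul_sub, sub_mul, sub_mul, e3]
    simp only [mul_assoc]
    abel
  rw [e]
  refine sub_mem ?_ ?_
  · convert mul_mem_filGT_left hmul (mul_mem_filGT_right hmul (hxpow j) (hyxp j' k)) (hypow k')
      using 2
    abel
  · convert mul_mem_filGT_left hmul (mul_mem_filGT_right hmul (hxpow j') (hyxp j k')) (hypow k)
      using 2
    abel

end FactorValue

/-! ### Independence of the reduced trace from the splitting -/

section ReducedTrace

/-- Skolem–Noether: an isomorphism of endomorphism algebras is conjugation by a linear equivalence.
-/
theorem Matrix.trace_algEquiv_apply {K : Type*} [Field K] {n m : Type*} [Fintype n] [DecidableEq n]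
    [Fintype m] [DecidableEq m] (f : Matrix n n K ≃ₐ[K] Matrix m m K) (M : Matrix n n K) :
    (f M).trace = M.trace := by
  let g : Module.End K (n → K) ≃ₐ[K] Module.End K (m → K) :=
    (Matrix.toLinAlgEquiv' (R := K) (n := n)).symm.trans (f.trans Matrix.toLinAlgEquiv')
  obtain ⟨T, hT⟩ := g.eq_linearEquivConjAlgEquiv
  have h1 : g (Matrix.toLin' M) = Matrix.toLin' (f M) := by
    change Matrix.toLin' (f (LinearMap.toMatrix' (Matrix.toLin' M))) = _
    rw [LinearMap.toMatrix'_toLin']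
  rw [← Matrix.trace_toLin'_eq, ← Matrix.trace_toLin'_eq, ← h1, hT]
  exact LinearMap.trace_conj' _ T

theorem reducedTrace_eq {F : Type u} [Field F] {A : Type u} [Ring A] [Algebra F A]
    {n : Type*} [Fintype n] [DecidableEq n]
    (e : AlgebraicClosure F ⊗[F] A ≃ₐ[AlgebraicClosure F] Matrix n n (AlgebraicClosure F))
    {a : A} {t : F} (h : (e (1 ⊗ₜ[F] a)).trace = algebraMap F (AlgebraicClosure F) t) :
    reducedTrace F a = t := by
  classical
  have hex : ∃ t : F, IsReducedTrace F a t := by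
    refine ⟨t, Fintype.card n, e.trans (Matrix.reindexAlgEquiv _ _ (Fintype.equivFin n)), ?_⟩
    rw [← h, AlgEquiv.trans_apply, Matrix.trace_algEquiv_apply]
  rw [reducedTrace, dif_pos hex]
  obtain ⟨d, e', he'⟩ := hex.choose_spec
  apply (algebraMap F (AlgebraicClosure F)).injective
  rw [← he', ← h, ← Matrix.trace_algEquiv_apply (e'.symm.trans e) (e' (1 ⊗ₜ[F] a))]
  simp

end ReducedTrace

/-! ### Kronecker products of families of matrices -/

section Kronecker

/-- The Kronecker product of a family of square matrices. -/
def Matrix.piKronecker (ι n K : Type*) [Fintype ι] [CommRing K] :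
    MultilinearMap K (fun _ : ι => Matrix n n K) (Matrix (ι → n) (ι → n) K) where
  toFun M := Matrix.of fun k l => ∏ i, M i (k i) (l i)
  map_update_add' M i a b := by
    ext k l
    simp only [Matrix.of_apply, Matrix.add_apply]
    rw [← Finset.mul_prod_erase _ _ (Finset.mem_univ i), ← Finset.mul_prod_erase _ _ (Finset.mem_univ i),
      ← Finset.mul_prod_erase _ _ (Finset.mem_univ i)]
    simp only [Function.update_self, Matrix.add_apply, add_mul]
    congr 2 <;> refine Finset.prod_congr rfl fun j hj => ?_ <;>
      rw [Function.update_of_ne (Finset.ne_of_mem_erase hj),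
        Function.update_of_ne (Finset.ne_of_mem_erase hj)]
  map_update_smul' M i c a := by
    ext k l
    simp only [Matrix.of_apply, Matrix.smul_apply]
    rw [← Finset.mul_prod_erase _ _ (Finset.mem_univ i), ← Finset.mul_prod_erase _ _ (Finset.mem_univ i)]
    simp only [Function.update_self, Matrix.smul_apply, smul_eq_mul, mul_assoc]
    congr 2
    refine Finset.prod_congr rfl fun j hj => ?_
    rw [Function.update_of_ne (Finset.ne_of_mem_erase hj),
        Function.update_of_ne (Finset.ne_of_mem_erase hj)]

variable {ι n K : Type*} [Fintype ι] [CommRing K]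

theorem Matrix.piKronecker_apply (M : ι → Matrix n n K) (k l : ι → n) :
    Matrix.piKronecker ι n K M k l = ∏ i, M i (k i) (l i) := rfl

theorem Matrix.piKronecker_one [DecidableEq n] :
    Matrix.piKronecker ι n K (fun _ => 1) = 1 := by
  classical
  ext k l
  simp [Matrix.piKronecker_apply, Matrix.one_apply, Fintype.prod_ite_zero, funext_iff]

theorem Matrix.piKronecker_mul [Fintype n] [DecidableEq ι] (M N : ι → Matrix n n K) :
    Matrix.piKronecker ι n K (fun i => M i * N i) =
      Matrix.piKronecker ι n K M * Matrix.piKronecker ι n K N := by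
  ext k l
  simp only [Matrix.piKronecker_apply, Matrix.mul_apply, Finset.prod_univ_sum,
    Finset.prod_mul_distrib, Fintype.piFinset_univ]

theorem Matrix.trace_piKronecker [Fintype n] [DecidableEq ι] (M : ι → Matrix n n K) :
    (Matrix.piKronecker ι n K M).trace = ∏ i, (M i).trace := by
  simp only [Matrix.piKronecker_apply, Matrix.trace, Matrix.diag, Finset.prod_univ_sum,
    Fintype.piFinset_univ]

theorem Matrix.piKronecker_single [DecidableEq n] (k l : ι → n) :
    Matrix.piKronecker ι n K (fun i => Matrix.single (k i) (l i) 1) = Matrix.single k l 1 := by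
  classical
  ext k' l'
  simp only [Matrix.piKronecker_apply, Matrix.single_apply, Fintype.prod_ite_zero]
  simp [funext_iff, forall_and]

end Kronecker

/-! ### Tensor products: filtration, splitting and trace -/

section Tensor

open PiTensorProduct

variable {F : Type*} [Field F] {ι : Type*} [Fintype ι] {Q : ι → Type*}
  [∀ i, Ring (Q i)] [∀ i, Algebra F (Q i)] {κ : Type*} [Finite κ]
  (B : ∀ i, Module.Basis κ F (Q i))

section Value

variable {Γ : Type*} [AddCommGroup Γ] [LinearOrder Γ]
  [IsOrderedAddMonoid Γ] {v : OrdVal F Γ} {p : ℕ} (ω : ι → κ → Γ)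

variable {B ω}

omit [Finite κ] in
theorem tprod_mem_filGE {γ : ι → Γ} {a : ∀ i, Q i}
    (ha : ∀ i, a i ∈ filGE v p (B i) (ω i) (γ i)) :
    tprod F a ∈ filGE v p (Basis.piTensorProduct B) (fun g => ∑ i, ω i (g i)) (∑ i, γ i) := by
  intro g hg
  rw [Basis.piTensorProduct_repr_tprod_apply] at hg ⊢
  rw [Finset.prod_ne_zero_iff] at hg
  rw [v.val_prod _ _ hg, Finset.smul_sum, ← Finset.sum_add_distrib]
  exact Finset.sum_le_sum fun i hi => ha i (g i) (hg i hi)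

omit [Fintype ι] in
-- Telescoping: `c C - d D = c (C - D) + (c - d) D`, where each summand has one factor of strictly
-- larger value.
theorem OrdVal.sum_lt_nsmul_val_prod_sub_prod (s : Finset ι) {γ w : ι → Γ} {c d : ι → F}
    (hc : ∀ i, c i ≠ 0 → γ i ≤ p • v.val (c i) + w i)
    (hd : ∀ i, d i ≠ 0 → γ i ≤ p • v.val (d i) + w i)
    (hcd : ∀ i, c i - d i ≠ 0 → γ i < p • v.val (c i - d i) + w i)
    (h : ∏ i ∈ s, c i - ∏ i ∈ s, d i ≠ 0) :
    ∑ i ∈ s, γ i < p • v.val (∏ i ∈ s, c i - ∏ i ∈ s, d i) + ∑ i ∈ s, w i := by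
  classical
  induction s using Finset.induction_on with
  | empty => simp at h
  | insert i s hi ih =>
    simp only [Finset.prod_insert hi, Finset.sum_insert hi] at h ⊢
    have e : c i * ∏ j ∈ s, c j - d i * ∏ j ∈ s, d j =
        c i * (∏ j ∈ s, c j - ∏ j ∈ s, d j) + (c i - d i) * ∏ j ∈ s, d j := by ring
    rw [e] at h ⊢
    refine v.lt_nsmul_val_add (fun h1 => ?_) (fun h1 => ?_) h
    · have h2 := left_ne_zero_of_mul h1
      have h3 := right_ne_zero_of_mul h1
      rw [v.map_mul _ _ h2 h3, smul_add, add_add_add_comm]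
      exact add_lt_add_of_le_of_lt (hc i h2) (ih h3)
    · have h2 := left_ne_zero_of_mul h1
      have h3 := right_ne_zero_of_mul h1
      rw [v.map_mul _ _ h2 h3, smul_add, add_add_add_comm]
      refine add_lt_add_of_lt_of_le (hcd i h2) ?_
      rw [Finset.prod_ne_zero_iff] at h3
      rw [v.val_prod _ _ h3, Finset.smul_sum, ← Finset.sum_add_distrib]
      exact Finset.sum_le_sum fun j hj => hd j (h3 j hj)

omit [Finite κ] in
theorem tprod_sub_tprod_mem_filGT {γ : ι → Γ} {a b : ∀ i, Q i}
    (ha : ∀ i, a i ∈ filGE v p (B i) (ω i) (γ i)) (hb : ∀ i, b i ∈ filGE v p (B i) (ω i) (γ i))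
    (hab : ∀ i, a i - b i ∈ filGT v p (B i) (ω i) (γ i)) :
    tprod F a - tprod F b ∈
      filGT v p (Basis.piTensorProduct B) (fun g => ∑ i, ω i (g i)) (∑ i, γ i) := by
  intro g hg
  simp only [map_sub, Finsupp.coe_sub, Pi.sub_apply, Basis.piTensorProduct_repr_tprod_apply]
    at hg ⊢
  refine OrdVal.sum_lt_nsmul_val_prod_sub_prod _ (fun i => ha i (g i)) (fun i => hb i (g i))
    (fun i => ?_) hg
  simpa using hab i (g i)

omit [Finite κ] in
theorem isGradedUnitBasis_piTensorProduct
    (hone : ∀ i, ∃ g, B i g = 1 ∧ ω i g = 0)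
    (hmul : ∀ i g h, B i g * B i h ∈ filGE v p (B i) (ω i) (ω i g + ω i h))
    (hinv : ∀ i g, ∃ u ∈ filGE v p (B i) (ω i) (-ω i g), u * B i g = 1)
    (hsep : ∀ (g h : ι → κ) (γ δ : Γ),
      p • γ + ∑ i, ω i (g i) = p • δ + ∑ i, ω i (h i) → g = h) :
    IsGradedUnitBasis v p (Basis.piTensorProduct B) (fun g => ∑ i, ω i (g i)) where
  exists_one := by
    choose g hg hg' using hone
    refine ⟨g, ?_, by simp [hg']⟩
    rw [Basis.piTensorProduct_apply]
    simp only [hg]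
    rfl
  mul_mem g h := by
    rw [Basis.piTensorProduct_apply, Basis.piTensorProduct_apply, tprod_mul_tprod,
      ← Finset.sum_add_distrib]
    exact tprod_mem_filGE fun i => hmul i (g i) (h i)
  exists_inv g := by
    choose u hu hu' using fun i => hinv i (g i)
    refine ⟨tprod F u, ?_, ?_⟩
    · rw [← Finset.sum_neg_distrib]
      exact tprod_mem_filGE hu
    · rw [Basis.piTensorProduct_apply, tprod_mul_tprod]
      have : (u * fun i => B i (g i)) = 1 := funext hu'
      rw [this]
      rfl
  sep := hsep

/-- If the basis elements of the factors commute up to terms of higher value, so do all elements of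
the tensor product. -/
theorem piTensorProduct_commutator_mem
    (hmul : ∀ i g h, B i g * B i h ∈ filGE v p (B i) (ω i) (ω i g + ω i h))
    (hcomm : ∀ i g h, B i g * B i h - B i h * B i g ∈ filGT v p (B i) (ω i) (ω i g + ω i h))
    {γ δ : Γ} {a b : ⨂[F] i, Q i}
    (ha : a ∈ filGE v p (Basis.piTensorProduct B) (fun g => ∑ i, ω i (g i)) γ)
    (hb : b ∈ filGE v p (Basis.piTensorProduct B) (fun g => ∑ i, ω i (g i)) δ) :
    a * b - b * a ∈ filGT v p (Basis.piTensorProduct B) (fun g => ∑ i, ω i (g i)) (γ + δ) := by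
  classical
  have := Fintype.ofFinite κ
  have hbasis : ∀ g h, Basis.piTensorProduct B g * Basis.piTensorProduct B h -
      Basis.piTensorProduct B h * Basis.piTensorProduct B g ∈
      filGT v p (Basis.piTensorProduct B) (fun g => ∑ i, ω i (g i))
        (∑ i, ω i (g i) + ∑ i, ω i (h i)) := by
    intro g h
    rw [Basis.piTensorProduct_apply, Basis.piTensorProduct_apply, tprod_mul_tprod, tprod_mul_tprod,
      ← Finset.sum_add_distrib]
    refine tprod_sub_tprod_mem_filGT (fun i => hmul i (g i) (h i)) (fun i => ?_)
      (fun i => hcomm i (g i) (h i))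
    rw [add_comm]
    exact hmul i (h i) (g i)
  rw [← (Basis.piTensorProduct B).sum_repr a, ← (Basis.piTensorProduct B).sum_repr b,
    Finset.sum_mul_sum, Finset.sum_mul_sum, Finset.sum_comm, ← Finset.sum_sub_distrib]
  refine sum_mem fun h _ => ?_
  rw [← Finset.sum_sub_distrib]
  refine sum_mem fun g _ => ?_
  by_cases h1 : (Basis.piTensorProduct B).repr a g = 0
  · simp [h1]
  by_cases h2 : (Basis.piTensorProduct B).repr b h = 0
  · simp [h2]
  rw [smul_mul_smul_comm, smul_mul_smul_comm, mul_comm ((Basis.piTensorProduct B).repr b h),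
    ← smul_sub]
  have h3 := smul_mem_filGT (hbasis g h) (mul_ne_zero h1 h2)
  intro k hk
  refine lt_of_le_of_lt ?_ (h3 k hk)
  rw [v.map_mul _ _ h1 h2, smul_add, add_add_add_comm]
  exact add_le_add (ha g h1) (hb h h2)

end Value

section Splitting

variable {K : Type*} [Field K] [Algebra F K] {n : Type*} [Fintype n] [DecidableEq n]
  [DecidableEq ι] (φ : ∀ i, Q i →ₐ[F] Matrix n n K)

/-- The tensor product of matrix representations. -/
def piTensorRep : (⨂[F] i, Q i) →ₐ[F] Matrix (ι → n) (ι → n) K :=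
  PiTensorProduct.liftAlgHom
    (((Matrix.piKronecker ι n K).restrictScalars F).compLinearMap fun i => (φ i).toLinearMap)
    (by simpa using Matrix.piKronecker_one)
    (fun x y => by
      simpa using Matrix.piKronecker_mul (fun i => φ i (x i)) (fun i => φ i (y i)))

theorem piTensorRep_tprod (a : ∀ i, Q i) :
    piTensorRep φ (tprod F a) = Matrix.piKronecker ι n K fun i => φ i (a i) := by
  simp [piTensorRep]

variable {B φ}

/-- Kronecker products of the images of the factors include all matrix units, so the extended
representation is onto; the dimensions agree, so it is bijective. -/
theorem exists_piTensor_splitting (C : ι → Module.Basis κ K (Matrix n n K))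
    (hC : ∀ i g, C i g = φ i (B i g)) :
    ∃ e : K ⊗[F] (⨂[F] i, Q i) ≃ₐ[K] Matrix (ι → n) (ι → n) K,
      ∀ a, e (1 ⊗ₜ a) = piTensorRep φ a := by
  classical
  have := Fintype.ofFinite κ
  let Φ : K ⊗[F] (⨂[F] i, Q i) →ₐ[K] Matrix (ι → n) (ι → n) K :=
    Algebra.TensorProduct.lift (Algebra.ofId K _) (piTensorRep φ) fun _ _ => Algebra.commutes _ _
  have hΦ : ∀ q, Φ (1 ⊗ₜ q) = piTensorRep φ q := by
    intro q
    exact (Algebra.TensorProduct.lift_tmul _ _ _ _ _).trans (by simp)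
  have hkron : ∀ M : ι → Matrix n n K, Matrix.piKronecker ι n K M ∈ Φ.range := by
    intro M
    have h1 : M = fun i => ∑ g, (C i).repr (M i) g • φ i (B i g) := by
      funext i
      simp only [← hC]
      exact ((C i).sum_repr (M i)).symm
    rw [h1, MultilinearMap.map_sum]
    refine sum_mem fun g _ => ?_
    rw [MultilinearMap.map_smul_univ]
    refine Subalgebra.smul_mem _ ?_ _
    exact ⟨1 ⊗ₜ tprod F fun i => B i (g i), by
      rw [← piTensorRep_tprod]; exact hΦ _⟩
  have hsurj : Function.Surjective Φ.toLinearMap := by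
    intro M
    have : M ∈ Φ.range := by
      rw [Matrix.matrix_eq_sum_single M]
      refine sum_mem fun k _ => sum_mem fun l _ => ?_
      have e : Matrix.single k l (M k l) = M k l • Matrix.single k l (1 : K) := by
        rw [Matrix.smul_single, smul_eq_mul, mul_one]
      rw [e, ← Matrix.piKronecker_single]
      exact Subalgebra.smul_mem _ (hkron _) _
    exact this
  have hbij : Function.Bijective Φ.toLinearMap := by
    refine ⟨?_, hsurj⟩
    have := Module.Finite.of_basis (Basis.piTensorProduct B)
    rw [LinearMap.injective_iff_surjective_of_finrank_eq_finrank]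
    · exact hsurj
    · rw [Module.finrank_baseChange, Module.finrank_eq_card_basis (Basis.piTensorProduct B),
        Module.finrank_matrix]
      simp only [Fintype.card_fun, Module.finrank_self, mul_one, ← mul_pow]
      -- The equality of `card κ` with the square of `card n` is read off one of the bases `C i`;
      -- for empty `ι` both sides are empty powers.
      rcases isEmpty_or_nonempty ι with h | ⟨⟨i⟩⟩
      · simp
      · have h := Module.finrank_eq_card_basis (C i)
        rw [Module.finrank_matrix, Module.finrank_self, mul_one] at h
        rw [h]
  exact ⟨AlgEquiv.ofBijective Φ hbij, hΦ⟩

/-- The trace of a Kronecker product is the product of the traces, so a basis tensor contributes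
only when every factor is the distinguished one. -/
theorem trace_piTensorRep {g₀ : ι → κ} {τ : ι → F} [DecidableEq κ]
    (hτ : ∀ i g, (φ i (B i g)).trace = if g = g₀ i then algebraMap F K (τ i) else 0)
    (a : ⨂[F] i, Q i) : (piTensorRep φ a).trace =
      algebraMap F K ((∏ i, τ i) * (Basis.piTensorProduct B).repr a g₀) := by
  have := Fintype.ofFinite κ
  conv_lhs => rw [← (Basis.piTensorProduct B).sum_repr a]
  rw [map_sum, Matrix.trace_sum, Finset.sum_eq_single g₀]
  · rw [map_smul, Matrix.trace_smul, Basis.piTensorProduct_apply, piTensorRep_tprod,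
      Matrix.trace_piKronecker]
    simp [hτ, Algebra.smul_def, mul_comm]
  · intro g _ hg
    rw [map_smul, Matrix.trace_smul, Basis.piTensorProduct_apply, piTensorRep_tprod,
      Matrix.trace_piKronecker]
    obtain ⟨i, hi⟩ := Function.ne_iff.1 hg
    rw [Finset.prod_eq_zero (Finset.mem_univ i), smul_zero]
    rw [hτ, if_neg hi]
  · simp

end Splitting

end Tensor

/-! ### Valuations on Laurent series fields -/

namespace OrdVal

variable {K : Type*} [Field K] {Γ : Type*} [AddCommGroup Γ] [LinearOrder Γ]

/-- The trivial valuation. -/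
def trivial (K : Type*) [Field K] : OrdVal K ℤ where
  val _ := 0
  map_mul := by simp
  map_add := by simp

/-- The extension of a valuation on `K` to the Laurent series field, by the order and the value of
the leading coefficient. -/
def laurent (v : OrdVal K Γ) : OrdVal (LaurentSeries K) (ℤ ×ₗ Γ) where
  val f := toLex (f.order, v.val f.leadingCoeff)
  map_mul f g hf hg := by
    rw [HahnSeries.order_mul hf hg, HahnSeries.leadingCoeff_mul,
      v.map_mul _ _ (HahnSeries.leadingCoeff_ne_zero.2 hf) (HahnSeries.leadingCoeff_ne_zero.2 hg)]
    rfl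
  map_add f g hf hg hfg := by
    have hmin := HahnSeries.min_order_le_order_add hfg
    -- If the order of the sum exceeds the minimum, the first lexicographic coordinate decides. If
    -- not, the leading coefficient comes from the summand of smaller order, or from both when the
    -- orders agree, and only then is `v` needed.
    by_cases h : min f.order g.order = (f + g).order
    · have hlc : (f + g).leadingCoeff = f.coeff (f + g).order + g.coeff (f + g).order := by
        rw [HahnSeries.leadingCoeff_eq, HahnSeries.coeff_add]
      rcases lt_trichotomy f.order g.order with h1 | h1 | h1
      · have h2 : (f + g).order = f.order := by rw [← h, min_eq_left h1.le]
        rw [h2, HahnSeries.coeff_eq_zero_of_lt_order h1, add_zero, ← HahnSeries.leadingCoeff_eq]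
          at hlc
        rw [h2, hlc]
        exact min_le_left _ _
      · have h2 : (f + g).order = f.order := by rw [← h, h1, min_self]
        have h3 : (f + g).leadingCoeff = f.leadingCoeff + g.leadingCoeff := by
          rw [hlc, h2, HahnSeries.leadingCoeff_eq, HahnSeries.leadingCoeff_eq, h1]
        have h4 := v.map_add _ _ (HahnSeries.leadingCoeff_ne_zero.2 hf)
          (HahnSeries.leadingCoeff_ne_zero.2 hg) (h3 ▸ HahnSeries.leadingCoeff_ne_zero.2 hfg)
        rw [← h1, h2, h3, min_le_iff, Prod.Lex.toLex_le_toLex, Prod.Lex.toLex_le_toLex]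
        rcases min_le_iff.1 h4 with h5 | h5
        · exact Or.inl (Or.inr ⟨rfl, h5⟩)
        · exact Or.inr (Or.inr ⟨rfl, h5⟩)
      · have h2 : (f + g).order = g.order := by rw [← h, min_eq_right h1.le]
        rw [h2, HahnSeries.coeff_eq_zero_of_lt_order h1, zero_add, ← HahnSeries.leadingCoeff_eq]
          at hlc
        rw [h2, hlc]
        exact min_le_right _ _
    · have h1 := lt_of_le_of_ne hmin h
      rw [min_le_iff, Prod.Lex.toLex_le_toLex, Prod.Lex.toLex_le_toLex]
      rcases min_lt_iff.1 h1 with h2 | h2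
      · exact Or.inl (Or.inl h2)
      · exact Or.inr (Or.inl h2)

theorem laurent_val_C (v : OrdVal K Γ) (c : K) :
    v.laurent.val (HahnSeries.C c) = toLex (0, v.val c) := by
  have h : (HahnSeries.C c : LaurentSeries K).leadingCoeff = c := by
    rw [HahnSeries.C_apply, HahnSeries.leadingCoeff_of_single]
  simp only [laurent, h, HahnSeries.order_C]

theorem laurent_val_single (v : OrdVal K Γ) :
    v.laurent.val (HahnSeries.single (-1 : ℤ) (1 : K)) = toLex (-1, 0) := by
  simp only [laurent, HahnSeries.leadingCoeff_of_single, HahnSeries.order_single one_ne_zero,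
    v.val_one]

variable [IsOrderedAddMonoid Γ] (v : OrdVal K Γ)

theorem lt_val_sum {ι : Type*} (s : Finset ι) (f : ι → K) {γ : Γ}
    (hf : ∀ i ∈ s, f i ≠ 0 → γ < v.val (f i)) (h : ∑ i ∈ s, f i ≠ 0) :
    γ < v.val (∑ i ∈ s, f i) := by
  classical
  induction s using Finset.induction_on with
  | empty => simp at h
  | insert i s hi ih =>
    rw [Finset.sum_insert hi] at h ⊢
    have h1 := v.lt_nsmul_val_add (p := 1) (w := 0) (γ := γ) (a := f i) (b := ∑ i ∈ s, f i)
      (fun h1 => by simpa using hf i (Finset.mem_insert_self i s) h1)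
      (fun h1 => by simpa using ih (fun j hj => hf j (Finset.mem_insert_of_mem hj)) h1) h
    simpa using h1

/-- The term of smallest value is unique and cannot be cancelled by terms of strictly larger value.
-/
theorem sum_ne_zero_of_injOn {ι : Type*} {s : Finset ι} (hs : s.Nonempty) {f : ι → K}
    (hf : ∀ i ∈ s, f i ≠ 0) (hinj : Set.InjOn (fun i => v.val (f i)) s) :
    ∑ i ∈ s, f i ≠ 0 := by
  classical
  obtain ⟨i, hi, hmin⟩ := Finset.exists_min_image s (fun i => v.val (f i)) hs
  intro h
  rw [← Finset.add_sum_erase _ _ hi] at h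
  have h1 : ∑ j ∈ s.erase i, f j = - f i := by rw [eq_neg_iff_add_eq_zero, add_comm, h]
  have h2 := v.lt_val_sum (s.erase i) f (γ := v.val (f i)) (fun j hj _ => ?_)
    (by rw [h1]; simpa using hf i hi)
  · rw [h1, v.val_neg] at h2
    exact lt_irrefl _ h2
  · have hj' := Finset.mem_of_mem_erase hj
    refine lt_of_le_of_ne (hmin j hj') fun heq => Finset.ne_of_mem_erase hj ?_
    exact (hinj hi hj' heq).symm

end OrdVal

/-! ### Independent values on the Laurent series and rational function fields -/

/-- A valuation on `F`, trivial on `F₀`, for which the values of the `αᵢ` and `βᵢ` are independent;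
independence is witnessed by coordinates on the value group. -/
structure IndepValuation {F₀ F : Type*} [Field F₀] [Field F] {m : ℕ} (c : F₀ →+* F) (α β : Fin m → F)
    (Γ : Type*) [AddCommGroup Γ] [LinearOrder Γ] where
  v : OrdVal F Γ
  coord : Γ →+ (Fin m → ℤ × ℤ)
  val_const : ∀ a, a ≠ 0 → v.val (c a) = 0
  val_alpha_neg : ∀ i, v.val (α i) < 0
  coord_alpha : ∀ i, coord (v.val (α i)) = Pi.single i (-1, 0)
  coord_beta : ∀ i, coord (v.val (β i)) = Pi.single i (0, -1)
  alpha_ne_zero : ∀ i, α i ≠ 0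
  beta_ne_zero : ∀ i, β i ≠ 0

/-- The pullback to a subfield containing the `αᵢ` and `βᵢ`. -/
def IndepValuation.comap {F₀ F E : Type*} [Field F₀] [Field F] [Field E] {m : ℕ} {c : F₀ →+* F}
    {α β : Fin m → F} {Γ : Type*} [AddCommGroup Γ] [LinearOrder Γ] (W : IndepValuation c α β Γ)
    (f : E →+* F) {c' : F₀ →+* E} {α' β' : Fin m → E} (hc : ∀ a, f (c' a) = c a)
    (hα : ∀ i, f (α' i) = α i) (hβ : ∀ i, f (β' i) = β i) : IndepValuation c' α' β' Γ where
  v := W.v.comap f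
  coord := W.coord
  val_const a ha := by simpa [OrdVal.comap, hc] using W.val_const a ha
  val_alpha_neg i := by simpa [OrdVal.comap, hα] using W.val_alpha_neg i
  coord_alpha i := by simpa [OrdVal.comap, hα] using W.coord_alpha i
  coord_beta i := by simpa [OrdVal.comap, hβ] using W.coord_beta i
  alpha_ne_zero i := by rw [← map_ne_zero f, hα]; exact W.alpha_ne_zero i
  beta_ne_zero i := by rw [← map_ne_zero f, hβ]; exact W.beta_ne_zero i

namespace IterLaurent

/-- Since the innermost pair of variables is adjoined first, the induction changes the base field,
so the base valuation `v₀` must be arbitrary. The map `r` recovers `v₀` on constants, and `π`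
records the exponents of the adjoined pairs; at the next stage the new pair is read off through `r`.
-/
theorem exists_ordVal (m : ℕ) : ∀ (K : Type u) [Field K] (Γ₀ : Type) [AddCommGroup Γ₀]
    [LinearOrder Γ₀] [IsOrderedAddMonoid Γ₀] (v₀ : OrdVal K Γ₀),
    ∃ (Γ : Type) (_ : AddCommGroup Γ) (_ : LinearOrder Γ) (_ : IsOrderedAddMonoid Γ)
      (v : OrdVal (IterLaurent m K) Γ) (r : Γ →+ Γ₀) (π : Γ →+ (Fin m → ℤ × ℤ)),
      (∀ a, v₀.val a = 0 → v.val (const m K a) = 0) ∧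
      (∀ a, v₀.val a < 0 → v.val (const m K a) < 0) ∧
      (∀ a, r (v.val (const m K a)) = v₀.val a) ∧
      (∀ a, π (v.val (const m K a)) = 0) ∧
      (∀ i, v.val (alpha m K i) < 0 ∧ r (v.val (alpha m K i)) = 0 ∧
        π (v.val (alpha m K i)) = Pi.single i (-1, 0) ∧ alpha m K i ≠ 0) ∧
      (∀ i, r (v.val (beta m K i)) = 0 ∧ π (v.val (beta m K i)) = Pi.single i (0, -1) ∧
        beta m K i ≠ 0) := by
  induction m with
  | zero =>
    intro K _ Γ₀ _ _ _ v₀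
    exact ⟨Γ₀, inferInstance, inferInstance, inferInstance, v₀, AddMonoidHom.id _, 0,
      fun a h => h, fun a h => h, fun a => rfl, fun a => rfl, fun i => i.elim0, fun i => i.elim0⟩
  | succ m ih =>
    intro K _ Γ₀ _ _ _ v₀
    obtain ⟨Γ, i1, i2, i3, v, r, π, h0, hneg, hr, hπ, hα, hβ⟩ :=
      ih (LaurentSeries (LaurentSeries K)) (ℤ ×ₗ (ℤ ×ₗ Γ₀)) v₀.laurent.laurent
    -- The outer Laurent variable belongs to `β` and the inner one to `α`, hence the swapped
    -- coordinates.
    let s : (ℤ ×ₗ (ℤ ×ₗ Γ₀)) →+ ℤ × ℤ :=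
      { toFun := fun γ => ((ofLex (ofLex γ).2).1, (ofLex γ).1)
        map_zero' := rfl
        map_add' := fun _ _ => rfl }
    let t : (ℤ ×ₗ (ℤ ×ₗ Γ₀)) →+ Γ₀ :=
      { toFun := fun γ => (ofLex (ofLex γ).2).2
        map_zero' := rfl
        map_add' := fun _ _ => rfl }
    let π' : Γ →+ (Fin (m + 1) → ℤ × ℤ) :=
      { toFun := fun γ => Fin.cons (s (r γ)) (π γ)
        map_zero' := by
          funext i
          refine Fin.cases ?_ (fun j => ?_) i <;> simp
        map_add' := fun a b => by
          funext i
          refine Fin.cases ?_ (fun j => ?_) i <;> simp }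
    have hs0 : ∀ x : ℤ × ℤ, (Fin.cons x 0 : Fin (m + 1) → ℤ × ℤ) = Pi.single 0 x := by
      intro x
      funext i
      refine Fin.cases ?_ (fun j => ?_) i <;> simp
    have hs1 : ∀ (x : ℤ × ℤ) (i : Fin m),
        (Fin.cons 0 (Pi.single i x) : Fin (m + 1) → ℤ × ℤ) = Pi.single i.succ x := by
      intro x i
      funext j
      refine Fin.cases ?_ (fun j => ?_) j
      · simp
      · simp [Pi.single_apply]
    have hC : ∀ a : K, v₀.laurent.laurent.val (HahnSeries.C (HahnSeries.C a)) =
        toLex (0, toLex (0, v₀.val a)) := fun a => by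
      rw [OrdVal.laurent_val_C, OrdVal.laurent_val_C]
    have hA : v₀.laurent.laurent.val (HahnSeries.C (HahnSeries.single (-1 : ℤ) (1 : K))) =
        toLex (0, toLex (-1, 0)) := by
      rw [OrdVal.laurent_val_C, OrdVal.laurent_val_single]
    have hB : v₀.laurent.laurent.val (HahnSeries.single (-1 : ℤ) (1 : LaurentSeries K)) =
        toLex (-1, 0) := OrdVal.laurent_val_single _
    refine ⟨Γ, i1, i2, i3, v, t.comp r, π', ?_, ?_, ?_, ?_, ?_, ?_⟩
    · intro a ha
      refine h0 _ ?_
      exact (hC a).trans (by rw [ha]; rfl)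
    · intro a ha
      refine hneg _ ?_
      refine (hC a).trans_lt ?_
      exact Prod.Lex.toLex_lt_toLex.2 (Or.inr ⟨rfl, Prod.Lex.toLex_lt_toLex.2 (Or.inr ⟨rfl, ha⟩)⟩)
    · intro a
      change t (r (v.val (const m _ (HahnSeries.C (HahnSeries.C a))))) = _
      rw [hr, hC]
      rfl
    · intro a
      change (Fin.cons (s (r (v.val (const m _ (HahnSeries.C (HahnSeries.C a))))))
        (π (v.val (const m _ (HahnSeries.C (HahnSeries.C a))))) : Fin (m + 1) → ℤ × ℤ) = 0
      rw [hr, hC, hπ, hs0]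
      exact Pi.single_zero 0
    · refine Fin.cases ?_ fun i => ?_
      · change v.val (const m _ (HahnSeries.C (HahnSeries.single (-1 : ℤ) (1 : K)))) < 0 ∧
          t (r (v.val (const m _ (HahnSeries.C (HahnSeries.single (-1 : ℤ) (1 : K)))))) = 0 ∧
          (Fin.cons (s (r (v.val (const m _ (HahnSeries.C (HahnSeries.single (-1 : ℤ) (1 : K)))))))
            (π (v.val (const m _ (HahnSeries.C (HahnSeries.single (-1 : ℤ) (1 : K)))))) :
            Fin (m + 1) → ℤ × ℤ) = _ ∧
          const m _ (HahnSeries.C (HahnSeries.single (-1 : ℤ) (1 : K))) ≠ 0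
        rw [hr, hA, hπ, hs0]
        refine ⟨hneg _ ?_, rfl, rfl, ?_⟩
        · rw [hA]
          refine Prod.Lex.toLex_lt_toLex.2 (Or.inr ⟨rfl, Prod.Lex.toLex_lt_toLex.2 (Or.inl ?_)⟩)
          exact neg_one_lt_zero
        · rw [map_ne_zero, map_ne_zero]
          exact HahnSeries.single_ne_zero one_ne_zero
      · obtain ⟨h1, h2, h3, h4⟩ := hα i
        change v.val (alpha m _ i) < 0 ∧ t (r (v.val (alpha m _ i))) = 0 ∧
          (Fin.cons (s (r (v.val (alpha m _ i)))) (π (v.val (alpha m _ i))) :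
            Fin (m + 1) → ℤ × ℤ) = _ ∧ alpha m _ i ≠ 0
        rw [h2, h3, map_zero, map_zero, hs1]
        exact ⟨h1, rfl, rfl, h4⟩
    · refine Fin.cases ?_ fun i => ?_
      · change t (r (v.val (const m _ (HahnSeries.single (-1 : ℤ) (1 : LaurentSeries K))))) = 0 ∧
          (Fin.cons (s (r (v.val (const m _ (HahnSeries.single (-1 : ℤ) (1 : LaurentSeries K))))))
            (π (v.val (const m _ (HahnSeries.single (-1 : ℤ) (1 : LaurentSeries K))))) :
            Fin (m + 1) → ℤ × ℤ) = _ ∧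
          const m _ (HahnSeries.single (-1 : ℤ) (1 : LaurentSeries K)) ≠ 0
        rw [hr, hB, hπ, hs0]
        refine ⟨rfl, rfl, ?_⟩
        rw [map_ne_zero]
        exact HahnSeries.single_ne_zero one_ne_zero
      · obtain ⟨h2, h3, h4⟩ := hβ i
        change t (r (v.val (beta m _ i))) = 0 ∧
          (Fin.cons (s (r (v.val (beta m _ i)))) (π (v.val (beta m _ i))) :
            Fin (m + 1) → ℤ × ℤ) = _ ∧ beta m _ i ≠ 0
        rw [h2, h3, map_zero, map_zero, hs1]
        exact ⟨rfl, rfl, h4⟩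

theorem exists_indepValuation (m : ℕ) (F₀ : Type u) [Field F₀] :
    ∃ (Γ : Type) (_ : AddCommGroup Γ) (_ : LinearOrder Γ) (_ : IsOrderedAddMonoid Γ),
      Nonempty (IndepValuation (const m F₀) (alpha m F₀) (beta m F₀) Γ) := by
  obtain ⟨Γ, i1, i2, i3, v, r, π, h0, hneg, hr, hπ, hα, hβ⟩ :=
    exists_ordVal m F₀ ℤ (OrdVal.trivial F₀)
  exact ⟨Γ, i1, i2, i3, ⟨{
    v := v
    coord := π
    val_const := fun a _ => h0 a rfl
    val_alpha_neg := fun i => (hα i).1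
    coord_alpha := fun i => (hα i).2.2.1
    coord_beta := fun i => (hβ i).2.1
    alpha_ne_zero := fun i => (hα i).2.2.2
    beta_ne_zero := fun i => (hβ i).2.2 }⟩⟩

end IterLaurent

/-- Constants have value zero, so distinct monomials take distinct values at the `αᵢ`, `βᵢ`, and no
polynomial relation can cancel. -/
theorem IndepValuation.eval₂_injective {F₀ F : Type*} [Field F₀] [Field F] {m : ℕ} {c : F₀ →+* F}
    {α β : Fin m → F} {Γ : Type*} [AddCommGroup Γ] [LinearOrder Γ] [IsOrderedAddMonoid Γ]
    (W : IndepValuation c α β Γ) :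
    Function.Injective (MvPolynomial.eval₂Hom c (Sum.elim α β)) := by
  rw [injective_iff_map_eq_zero]
  intro f hf
  by_contra h0
  have hne : ∀ i, Sum.elim α β i ≠ 0 := by
    rintro (i | i)
    · exact W.alpha_ne_zero i
    · exact W.beta_ne_zero i
  have hprod : ∀ n : Fin m ⊕ Fin m →₀ ℕ, ∏ i, Sum.elim α β i ^ n i ≠ 0 := fun n =>
    Finset.prod_ne_zero_iff.2 fun i _ => pow_ne_zero _ (hne i)
  have hc : ∀ n ∈ f.support, c (f.coeff n) ≠ 0 := fun n hn => by
    rw [map_ne_zero]; exact MvPolynomial.mem_support_iff.1 hn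
  rw [MvPolynomial.coe_eval₂Hom, MvPolynomial.eval₂_eq'] at hf
  refine W.v.sum_ne_zero_of_injOn (MvPolynomial.support_nonempty.2 h0)
    (fun n hn => mul_ne_zero (hc n hn) (hprod n)) ?_ hf
  have hval : ∀ n ∈ f.support, W.v.val (c (f.coeff n) * ∏ i, Sum.elim α β i ^ n i) =
      ∑ i, n i • W.v.val (Sum.elim α β i) := by
    intro n hn
    rw [W.v.map_mul _ _ (hc n hn) (hprod n), W.val_const _ (MvPolynomial.mem_support_iff.1 hn),
      zero_add, W.v.val_prod _ _ (fun i _ => pow_ne_zero _ (hne i))]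
    exact Finset.sum_congr rfl fun i _ => W.v.val_pow (hne i) _
  have hcoord : ∀ n ∈ f.support, ∀ i, W.coord (W.v.val (c (f.coeff n) *
      ∏ i, Sum.elim α β i ^ n i)) i = (-(n (Sum.inl i) : ℤ), -(n (Sum.inr i) : ℤ)) := by
    intro n hn i
    rw [hval n hn, map_sum, Fintype.sum_sum_type]
    simp only [map_nsmul, Sum.elim_inl, Sum.elim_inr, W.coord_alpha, W.coord_beta, Pi.add_apply,
      Finset.sum_apply, Pi.smul_apply, Pi.single_apply, smul_ite, smul_zero, Finset.sum_ite_eq,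
      Finset.mem_univ, if_true]
    simp
  intro n hn n' hn' heq
  dsimp only at heq
  have key : ∀ i, (-(n (Sum.inl i) : ℤ), -(n (Sum.inr i) : ℤ)) =
      (-(n' (Sum.inl i) : ℤ), -(n' (Sum.inr i) : ℤ)) := fun i => by
    rw [← hcoord n hn i, ← hcoord n' hn' i, heq]
  ext (i | i)
  · have := (Prod.ext_iff.1 (key i)).1
    simp only at this
    omega
  · have := (Prod.ext_iff.1 (key i)).2
    simp only at this
    omega

/-- The rational function field embeds into the iterated Laurent series field, and the valuation
restricts. -/
theorem RatField.exists_indepValuation (m : ℕ) (F₀ : Type u) [Field F₀] :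
    ∃ (Γ : Type) (_ : AddCommGroup Γ) (_ : LinearOrder Γ) (_ : IsOrderedAddMonoid Γ),
      Nonempty (IndepValuation (algebraMap F₀ (RatField m F₀)) (RatField.alpha m F₀)
        (RatField.beta m F₀) Γ) := by
  obtain ⟨Γ, i1, i2, i3, ⟨W⟩⟩ := IterLaurent.exists_indepValuation m F₀
  refine ⟨Γ, i1, i2, i3, ⟨W.comap (IsFractionRing.lift W.eval₂_injective) ?_ ?_ ?_⟩⟩
  · intro a
    rw [IsScalarTower.algebraMap_apply F₀ (MvPolynomial (Fin m ⊕ Fin m) F₀) (RatField m F₀),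
      IsFractionRing.lift_algebraMap, MvPolynomial.algebraMap_eq, MvPolynomial.coe_eval₂Hom,
      MvPolynomial.eval₂_C]
  · intro i
    rw [RatField.alpha, IsFractionRing.lift_algebraMap]
    simp
  · intro i
    rw [RatField.beta, IsFractionRing.lift_algebraMap]
    simp

/-! ### The bound for tensor products of symbol algebras -/

open PiTensorProduct LinearAlgebra.Projectivization in
/-- The dimension bound for tensor products of algebras of symbol type. The trace of `x ^ j * y ^ k`
is nonzero for a single `(j, k)`, namely `(j₀, 0)`. -/
theorem rank_le_of_symbolGens {p : ℕ} (hp : p.Prime) {m : ℕ} {F₀ F : Type u} [Field F₀] [Field F]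
    [NeZero p] (hchar : ringChar F₀ = 0 ∨ p ≤ ringChar F₀) {c : F₀ →+* F} {α β : Fin m → F}
    (hW : ∃ (Γ : Type) (_ : AddCommGroup Γ) (_ : LinearOrder Γ) (_ : IsOrderedAddMonoid Γ),
      Nonempty (IndepValuation c α β Γ))
    {Q : Fin m → Type u} [∀ i, Ring (Q i)] [∀ i, Algebra F (Q i)] {x y : ∀ i, Q i} {ρ ε : F₀}
    (hρ : ρ ≠ 0) (D : ∀ i, SymbolGens p (c ρ) (c ε) (α i) (β i) (x i) (y i))
    {φ : ∀ i, Q i →ₐ[F] Matrix (ZMod p) (ZMod p) (AlgebraicClosure F)}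
    {d : Fin m → ZMod p → AlgebraicClosure F} {b : Fin m → AlgebraicClosure F}
    (R : ∀ i, SymbolRep p (x i) (y i) (φ i) (d i) (b i))
    {j₀ : ℕ} (hj₀ : j₀ = 0 ∨ ρ = 1) (hj₀p : j₀ < p) {τ : F} (hτ : τ ≠ 0)
    (htr : ∀ i, ∀ j < p, ∑ t, d i t ^ j =
      if j = j₀ then algebraMap F (AlgebraicClosure F) τ else 0)
    (V : Submodule F (⨂[F] i, Q i)) (hV : ∀ a ∈ V, reducedTrace F (a ^ (p - 1)) = 0) :
    Module.rank F V ≤ (((p ^ (2 * m) - 1) / (p - 1) : ℕ) : Cardinal) := by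
  have : Fact p.Prime := ⟨hp⟩
  obtain ⟨Γ, _, _, _, ⟨W⟩⟩ := hW
  have hF₀ : ∀ k : ℕ, 0 < k → k < p → (k : F₀) ≠ 0 := by
    intro k h0 hk hk0
    have h1 := (ringChar.spec F₀ k).1 hk0
    rcases hchar with h | h
    · rw [h, zero_dvd_iff] at h1; omega
    · have := Nat.le_of_dvd h0 h1; omega
  have hF : ∀ k : ℕ, 0 < k → k < p → (k : F) ≠ 0 := by
    intro k h0 hk
    rw [← map_natCast c, map_ne_zero]
    exact hF₀ k h0 hk
  have hval : ∀ k : ℕ, (k : F) ≠ 0 → W.v.val (k : F) = 0 := by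
    intro k hk
    rw [← map_natCast c] at hk ⊢
    exact W.val_const _ ((map_ne_zero c).1 hk)
  have hvε : c ε ≠ 0 → W.v.val (c ε) = 0 := fun h => W.val_const _ ((map_ne_zero c).1 h)
  have hvρ : W.v.val (c ρ) = 0 := W.val_const _ hρ
  choose B hB C hC using fun i => (D i).exists_basis hp.one_lt (R i)
  let ω : Fin m → Fin p × Fin p → Γ := fun i => symbolWeight W.v (α i) (β i)
  -- The sign turns the coordinates `-1` of `αᵢ` and `βᵢ` into `1`, so classes are the exponents
  -- modulo `p`.
  let red : ℤ × ℤ →+ ZMod p × ZMod p :=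
    -((Int.castAddHom (ZMod p)).prodMap (Int.castAddHom (ZMod p)))
  let π : Γ →+ (Fin m → ZMod p × ZMod p) := (red.compLeft (Fin m)).comp W.coord
  let cl : (Fin m → Fin p × Fin p) → (Fin m → ZMod p × ZMod p) := fun g i =>
    (((g i).1 : ℕ), ((g i).2 : ℕ))
  have hcl : Function.Injective cl := by
    have hfin : ∀ a b : Fin p, (((a : ℕ) : ZMod p)) = ((b : ℕ) : ZMod p) → a = b := by
      intro a b h
      rw [ZMod.natCast_eq_natCast_iff', Nat.mod_eq_of_lt a.2, Nat.mod_eq_of_lt b.2] at h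
      exact Fin.ext h
    intro g h hgh
    funext i
    have := congrFun hgh i
    exact Prod.ext (hfin _ _ (Prod.ext_iff.1 this).1) (hfin _ _ (Prod.ext_iff.1 this).2)
  have hπ : ∀ g : Fin m → Fin p × Fin p, π (∑ i, ω i (g i)) = cl g := by
    intro g
    funext i
    simp only [π, ω, symbolWeight, AddMonoidHom.comp_apply, map_sum, map_add, map_nsmul,
      W.coord_alpha, W.coord_beta, AddMonoidHom.compLeft_apply, Function.comp_apply,
      Finset.sum_apply, Pi.add_apply, Pi.smul_apply, Pi.single_apply]
    rw [Finset.sum_eq_single i]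
    · simp [red, cl]
    · intro j _ hj
      simp [hj.symm]
    · simp
  have hpG : ∀ g : Fin m → ZMod p × ZMod p, p • g = 0 := fun g => by
    rw [← Nat.cast_smul_eq_nsmul (ZMod p)]; simp
  have hmul : ∀ i g h, B i g * B i h ∈ filGE W.v p (B i) (ω i) (ω i g + ω i h) := fun i =>
    (D i).basis_mul_mem hp.one_lt (W.alpha_ne_zero i) (W.beta_ne_zero i) (W.val_alpha_neg i) hvρ hvε
      (hB i)
  have H : IsGradedUnitBasis W.v p (Basis.piTensorProduct B) (fun g => ∑ i, ω i (g i)) := by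
    refine isGradedUnitBasis_piTensorProduct (fun i => ?_) hmul (fun i =>
      (D i).basis_exists_inv hp.one_lt (W.alpha_ne_zero i) (W.beta_ne_zero i)
        (W.val_alpha_neg i) hvρ hvε (hB i)) ?_
    · exact ⟨(⟨0, hp.pos⟩, ⟨0, hp.pos⟩), by simp [hB], by simp [ω, symbolWeight]⟩
    · intro g h γ δ heq
      have h1 := congrArg π heq
      rw [map_add, map_add, map_nsmul, map_nsmul, hpG, hpG, zero_add, zero_add, hπ, hπ] at h1
      exact hcl h1
  let g₀ : Fin m → Fin p × Fin p := fun _ => (⟨j₀, hj₀p⟩, ⟨0, hp.pos⟩)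
  have hred : ∀ a : ⨂[F] i, Q i,
      reducedTrace F a = (∏ _i : Fin m, τ) * (Basis.piTensorProduct B).repr a g₀ := by
    intro a
    obtain ⟨e, he⟩ := exists_piTensor_splitting C hC
    refine reducedTrace_eq e ?_
    rw [he]
    refine trace_piTensorRep (fun i g => ?_) a
    obtain ⟨⟨j, hj⟩, ⟨k, hk⟩⟩ := g
    rw [hB, (R i).trace_map _ _ hk, htr i _ hj]
    simp only [g₀, Prod.mk.injEq, Fin.mk.injEq]
    by_cases h1 : k = 0 <;> by_cases h2 : j = j₀ <;> simp [h1, h2]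
  -- Modulo `p`, `(p - 1) • e = -e`, so `e` is the negative of the class `(j₀, 0)` of `g₀`.
  let e : Fin m → ZMod p × ZMod p := fun _ => (-(j₀ : ZMod p), 0)
  have he : cl g₀ = (p - 1) • e := by
    have h1 : ((p - 1 : ℕ) : ZMod p) = -1 := by rw [Nat.cast_sub hp.one_lt.le]; simp
    rw [← Nat.cast_smul_eq_nsmul (ZMod p), h1]
    funext i
    simp [cl, g₀, e]
  let T : (⨂[F] i, Q i) →ₗ[F] F := (∏ _i : Fin m, τ) • (Basis.piTensorProduct B).coord g₀
  have hcard : Nat.card (ℙ (ZMod p) (Fin m → ZMod p × ZMod p)) = (p ^ (2 * m) - 1) / (p - 1) := by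
    rw [Projectivization.card'']
    simp only [Nat.card_eq_fintype_card, Fintype.card_fun, Fintype.card_prod, ZMod.card,
      Fintype.card_fin]
    rw [pow_mul, pow_two]
  rw [← hcard]
  refine H.rank_le hcl hπ hF hval T (∏ _i : Fin m, τ) (Finset.prod_ne_zero_iff.2 fun _ _ => hτ)
    g₀ (fun a => rfl) e he ?_ V (fun a ha => (hred _).symm.trans (hV a ha))
  intro a a' γ δ ha ha' k hk
  -- For `j₀ = 0`, `e` is zero and the class of `a'` is a multiple of that of `a`. For `ρ = 1` all
  -- elements commute to leading order, whatever their classes.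
  rcases hj₀ with h | h
  · have he0 : e = 0 := by
      funext i
      simp [e, h]
    rw [he0, sub_zero, sub_zero] at hk
    refine H.commutator_mem_of_class_eq_nsmul hcl hpG hπ ha ha' k.val ?_
    rw [hk, ← Nat.cast_smul_eq_nsmul (ZMod p), ZMod.natCast_zmod_val]
  · rw [add_comm]
    refine piTensorProduct_commutator_mem hmul (fun i => ?_) ha'.1 ha.1
    exact (D i).basis_commutator_mem hp.one_lt (W.alpha_ne_zero i) (W.beta_ne_zero i)
      (W.val_alpha_neg i) hvρ hvε (hB i) (by rw [h, map_one])

/-! ### Matrix models of the two presentations -/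

section Matrices

variable {K : Type*} [Field K] {p : ℕ} [NeZero p] {ρ ε α β : K} {d : ZMod p → K} {b : K}

theorem Matrix.cyclicShift_mul_diagonal (hd : ∀ t, d (t + 1) = ρ * d t + ε) :
    (b • Matrix.of fun i j : ZMod p => if j = i + 1 then (1 : K) else 0) * Matrix.diagonal d =
      (ρ • Matrix.diagonal d + ε • 1) *
        (b • Matrix.of fun i j : ZMod p => if j = i + 1 then (1 : K) else 0) := by
  have h1 : (ρ • Matrix.diagonal d + ε • 1 : Matrix (ZMod p) (ZMod p) K) =
      Matrix.diagonal fun t => d (t + 1) := by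
    ext i j
    by_cases h : i = j
    · subst h; simp [hd]
    · simp [h]
  rw [h1]
  ext i j
  rw [Matrix.mul_diagonal, Matrix.diagonal_mul]
  by_cases h : j = i + 1
  · subst h; simp [mul_comm]
  · simp [h]

theorem Matrix.smul_cyclicShift_pow_self (hb : b ^ p = β) :
    (b • Matrix.of fun i j : ZMod p => if j = i + 1 then (1 : K) else 0) ^ p =
      algebraMap K _ β := by
  rw [smul_pow, Matrix.cyclicShift_pow, hb, Algebra.algebraMap_eq_smul_one]
  congr 1
  ext i j
  simp [Matrix.one_apply, eq_comm]

theorem Matrix.diagonal_pow_eq (hd : ∀ t, d t ^ p = α + ε * d t) :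
    Matrix.diagonal d ^ p = algebraMap K (Matrix (ZMod p) (ZMod p) K) α + ε • Matrix.diagonal d := by
  rw [Matrix.diagonal_pow]
  ext i j
  by_cases h : i = j
  · subst h; simp [hd, Matrix.algebraMap_matrix_apply]
  · simp [h, Matrix.algebraMap_matrix_apply]

end Matrices

theorem RingQuot.adjoin_mkAlgHom_ι {F : Type*} [Field F]
    (r : FreeAlgebra F (Fin 2) → FreeAlgebra F (Fin 2) → Prop) :
    Algebra.adjoin F {RingQuot.mkAlgHom F r (FreeAlgebra.ι F 0),
      RingQuot.mkAlgHom F r (FreeAlgebra.ι F 1)} = ⊤ := by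
  have h1 : ({RingQuot.mkAlgHom F r (FreeAlgebra.ι F 0),
      RingQuot.mkAlgHom F r (FreeAlgebra.ι F 1)} : Set (RingQuot r)) =
      RingQuot.mkAlgHom F r '' Set.range (FreeAlgebra.ι F) := by
    ext z
    simp [eq_comm]
  rw [h1, ← AlgHom.map_adjoin, FreeAlgebra.adjoin_range_ι, Algebra.map_top,
    AlgHom.range_eq_top]
  exact RingQuot.mkAlgHom_surjective F r

/-! ### Symbol algebras in characteristic different from `p` -/

section Symbol

variable {F : Type u} [Field F] (p : ℕ) (ρ α β : F)

/-- The generator `x` of `(α, β)_{p,F}`. -/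
def SymbolAlgebra.x : SymbolAlgebra p ρ α β :=
  RingQuot.mkAlgHom F (SymbolRel p ρ α β) (FreeAlgebra.ι F 0)

/-- The generator `y` of `(α, β)_{p,F}`. -/
def SymbolAlgebra.y : SymbolAlgebra p ρ α β :=
  RingQuot.mkAlgHom F (SymbolRel p ρ α β) (FreeAlgebra.ι F 1)

theorem SymbolAlgebra.symbolGens :
    SymbolGens p ρ 0 α β (SymbolAlgebra.x p ρ α β) (SymbolAlgebra.y p ρ α β) where
  x_pow := by
    have h := RingQuot.mkAlgHom_rel F (SymbolRel.x_pow (p := p) (ρ := ρ) (α := α) (β := β))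
    rw [map_pow, AlgHom.commutes] at h
    rw [zero_smul, add_zero]
    exact h
  y_pow := by
    have h := RingQuot.mkAlgHom_rel F (SymbolRel.y_pow (p := p) (ρ := ρ) (α := α) (β := β))
    rw [map_pow, AlgHom.commutes] at h
    exact h
  comm := by
    have h := RingQuot.mkAlgHom_rel F (SymbolRel.comm (p := p) (ρ := ρ) (α := α) (β := β))
    rw [map_mul, map_mul, map_mul, AlgHom.commutes, ← Algebra.smul_def] at h
    rw [zero_smul, add_zero]
    exact h
  adjoin := RingQuot.adjoin_mkAlgHom_ι _

variable {p ρ α β}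

theorem SymbolAlgebra.exists_symbolRep {K : Type*} [Field K] [Algebra F K] [NeZero p]
    {d : ZMod p → K} {b : K} (hd : ∀ t, d (t + 1) = algebraMap F K ρ * d t)
    (hd' : ∀ t, d t ^ p = algebraMap F K α) (hb : b ^ p = algebraMap F K β)
    (hinj : Function.Injective d) (hb0 : b ≠ 0) :
    ∃ φ : SymbolAlgebra p ρ α β →ₐ[F] Matrix (ZMod p) (ZMod p) K,
      SymbolRep p (SymbolAlgebra.x p ρ α β) (SymbolAlgebra.y p ρ α β) φ d b := by
  let s : Matrix (ZMod p) (ZMod p) K := b • Matrix.of fun i j : ZMod p => if j = i + 1 then 1 else 0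
  let f : FreeAlgebra F (Fin 2) →ₐ[F] Matrix (ZMod p) (ZMod p) K :=
    FreeAlgebra.lift F ![Matrix.diagonal d, s]
  have hf0 : f (FreeAlgebra.ι F 0) = Matrix.diagonal d := by simp [f]
  have hf1 : f (FreeAlgebra.ι F 1) = s := by simp [f]
  have hmap : ∀ z : F, algebraMap F (Matrix (ZMod p) (ZMod p) K) z =
      algebraMap K _ (algebraMap F K z) := fun z => IsScalarTower.algebraMap_apply F K _ z
  have hrel : ∀ ⦃u w⦄, SymbolRel p ρ α β u w → f u = f w := by
    intro u w h
    induction h with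
    | x_pow =>
      rw [map_pow, hf0, AlgHom.commutes, hmap, Matrix.diagonal_pow_eq (ε := 0) (by simpa using hd')]
      simp
    | y_pow =>
      rw [map_pow, hf1, AlgHom.commutes, hmap]
      exact Matrix.smul_cyclicShift_pow_self hb
    | comm =>
      rw [map_mul, map_mul, map_mul, hf1, hf0, AlgHom.commutes, hmap, ← Algebra.smul_def]
      have := Matrix.cyclicShift_mul_diagonal (b := b) (d := d) (ρ := algebraMap F K ρ) (ε := 0)
        (by simpa using hd)
      rwa [zero_smul, add_zero] at this
  exact ⟨RingQuot.liftAlgHom F ⟨f, hrel⟩,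
    (RingQuot.liftAlgHom_mkAlgHom_apply F f hrel _).trans hf0,
    (RingQuot.liftAlgHom_mkAlgHom_apply F f hrel _).trans hf1, hinj, hb0⟩

/-- The diagonal representation of `x` in the split symbol algebra. -/
theorem SymbolAlgebra.exists_diagonal (hp : p.Prime) [NeZero p] (hρ : IsPrimitiveRoot ρ p)
    (hα : α ≠ 0) (K : Type*) [Field K] [IsAlgClosed K] [Algebra F K] :
    ∃ d : ZMod p → K, (∀ t, d (t + 1) = algebraMap F K ρ * d t) ∧
      (∀ t, d t ^ p = algebraMap F K α) ∧ Function.Injective d ∧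
      ∀ j < p, ∑ t, d t ^ j = if j = 0 then algebraMap F K p else 0 := by
  have hρK : IsPrimitiveRoot (algebraMap F K ρ) p :=
    hρ.map_of_injective (algebraMap F K).injective
  set r := algebraMap F K ρ with hr
  obtain ⟨a, ha⟩ := IsAlgClosed.exists_pow_nat_eq (algebraMap F K α) hp.pos
  have ha0 : a ≠ 0 := by
    rintro rfl
    rw [zero_pow hp.ne_zero] at ha
    exact hα ((map_eq_zero _).1 ha.symm)
  have : Fact (1 < p) := ⟨hp.one_lt⟩
  have hstep : ∀ t : ZMod p, a * r ^ (t + 1).val = r * (a * r ^ t.val) := by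
    intro t
    have h1 : r ^ (t + 1).val = r ^ (t.val + 1) := by
      rw [ZMod.val_add, ZMod.val_one, ← pow_eq_pow_mod _ hρK.pow_eq_one]
    rw [h1, pow_succ]; ring
  refine ⟨fun t => a * r ^ t.val, hstep, fun t => ?_, fun t t' h => ?_, fun j hj => ?_⟩
  · rw [mul_pow, ha, ← pow_mul, mul_comm t.val, pow_mul, hρK.pow_eq_one, one_pow, mul_one]
  · exact ZMod.val_injective p (hρK.pow_inj t.val_lt t'.val_lt (mul_left_cancel₀ ha0 h))
  · split_ifs with h0
    · simp [h0, ZMod.card]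
    -- The shift `t ↦ t + 1` multiplies the power sum by `r ^ j ≠ 1`, so the sum vanishes.
    · have h1 : ∑ t : ZMod p, (a * r ^ t.val) ^ j = r ^ j * ∑ t : ZMod p, (a * r ^ t.val) ^ j := by
        rw [Finset.mul_sum, ← Equiv.sum_comp (Equiv.addRight (1 : ZMod p))]
        refine Finset.sum_congr rfl fun t _ => ?_
        rw [Equiv.coe_addRight, hstep, mul_pow]
      have h2 : r ^ j ≠ 1 := hρK.pow_ne_one_of_pos_of_lt h0 hj
      have h3 : (1 - r ^ j) * ∑ t : ZMod p, (a * r ^ t.val) ^ j = 0 := by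
        rw [sub_mul, one_mul, ← h1, sub_self]
      exact (mul_eq_zero.1 h3).resolve_left (sub_ne_zero.2 h2.symm)

end Symbol

/-! ### Symbol algebras in characteristic `p` -/

section CharPSymbol

variable {F : Type u} [Field F] (p : ℕ) (α β : F)

/-- The generator `x` of `[α, β)_{p,F}`. -/
def CharPSymbolAlgebra.x : CharPSymbolAlgebra p α β :=
  RingQuot.mkAlgHom F (CharPSymbolRel p α β) (FreeAlgebra.ι F 0)

/-- The generator `y` of `[α, β)_{p,F}`. -/
def CharPSymbolAlgebra.y : CharPSymbolAlgebra p α β :=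
  RingQuot.mkAlgHom F (CharPSymbolRel p α β) (FreeAlgebra.ι F 1)

theorem CharPSymbolAlgebra.symbolGens :
    SymbolGens p 1 1 α β (CharPSymbolAlgebra.x p α β) (CharPSymbolAlgebra.y p α β) where
  x_pow := by
    have h := RingQuot.mkAlgHom_rel F (CharPSymbolRel.x_pow (p := p) (α := α) (β := β))
    rw [map_sub, map_pow, AlgHom.commutes, sub_eq_iff_eq_add] at h
    rw [one_smul]
    exact h
  y_pow := by
    have h := RingQuot.mkAlgHom_rel F (CharPSymbolRel.y_pow (p := p) (α := α) (β := β))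
    rw [map_pow, AlgHom.commutes] at h
    exact h
  comm := by
    have h := RingQuot.mkAlgHom_rel F (CharPSymbolRel.comm (p := p) (α := α) (β := β))
    rw [map_mul, map_mul, map_add, map_one] at h
    rw [one_smul, one_smul]
    exact h
  adjoin := RingQuot.adjoin_mkAlgHom_ι _

variable {p α β}

theorem CharPSymbolAlgebra.exists_symbolRep {K : Type*} [Field K] [Algebra F K] [NeZero p]
    {d : ZMod p → K} {b : K} (hd : ∀ t, d (t + 1) = d t + 1)
    (hd' : ∀ t, d t ^ p = algebraMap F K α + d t) (hb : b ^ p = algebraMap F K β)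
    (hinj : Function.Injective d) (hb0 : b ≠ 0) :
    ∃ φ : CharPSymbolAlgebra p α β →ₐ[F] Matrix (ZMod p) (ZMod p) K,
      SymbolRep p (CharPSymbolAlgebra.x p α β) (CharPSymbolAlgebra.y p α β) φ d b := by
  let s : Matrix (ZMod p) (ZMod p) K := b • Matrix.of fun i j : ZMod p => if j = i + 1 then 1 else 0
  let f : FreeAlgebra F (Fin 2) →ₐ[F] Matrix (ZMod p) (ZMod p) K :=
    FreeAlgebra.lift F ![Matrix.diagonal d, s]
  have hf0 : f (FreeAlgebra.ι F 0) = Matrix.diagonal d := by simp [f]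
  have hf1 : f (FreeAlgebra.ι F 1) = s := by simp [f]
  have hmap : ∀ z : F, algebraMap F (Matrix (ZMod p) (ZMod p) K) z =
      algebraMap K _ (algebraMap F K z) := fun z => IsScalarTower.algebraMap_apply F K _ z
  have hrel : ∀ ⦃u w⦄, CharPSymbolRel p α β u w → f u = f w := by
    intro u w h
    induction h with
    | x_pow =>
      rw [map_sub, map_pow, hf0, AlgHom.commutes, hmap,
        Matrix.diagonal_pow_eq (ε := 1) (by simpa using hd')]
      simp
    | y_pow =>
      rw [map_pow, hf1, AlgHom.commutes, hmap]
      exact Matrix.smul_cyclicShift_pow_self hb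
    | comm =>
      rw [map_mul, map_mul, map_add, map_one, hf1, hf0]
      have := Matrix.cyclicShift_mul_diagonal (b := b) (d := d) (ρ := 1) (ε := 1)
        (by simpa using hd)
      rwa [one_smul, one_smul] at this
  exact ⟨RingQuot.liftAlgHom F ⟨f, hrel⟩,
    (RingQuot.liftAlgHom_mkAlgHom_apply F f hrel _).trans hf0,
    (RingQuot.liftAlgHom_mkAlgHom_apply F f hrel _).trans hf1, hinj, hb0⟩

/-- Power sums over the prime field, translated. -/
theorem ZMod.sum_add_castHom_pow {K : Type*} [Field K] (hp : p.Prime) [NeZero p] [CharP K p] (a : K)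
    {j : ℕ} (hj : j < p) : ∑ t : ZMod p, (a + ZMod.castHom dvd_rfl K t) ^ j =
      if j = p - 1 then -1 else 0 := by
  have : Fact p.Prime := ⟨hp⟩
  have h1 : ∀ i < p - 1, ∑ t : ZMod p, (ZMod.castHom dvd_rfl K t) ^ i = 0 := by
    intro i hi
    have := FiniteField.sum_pow_lt_card_sub_one (ZMod p) i (by rwa [ZMod.card])
    simp only [← map_pow]
    rw [← map_sum, this, map_zero]
  have h2 : ∑ t : ZMod p, (ZMod.castHom dvd_rfl K t) ^ (p - 1) = -1 := by
    have : ∑ t : ZMod p, t ^ (p - 1) = -1 := by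
      have h3 : ∀ t : ZMod p, t ^ (p - 1) = 1 - if t = 0 then 1 else 0 := by
        intro t
        split_ifs with h
        · rw [h, zero_pow (by have := hp.one_lt; omega), sub_self]
        · rw [ZMod.pow_card_sub_one_eq_one h, sub_zero]
      simp [h3, ZMod.card]
    simp only [← map_pow]
    rw [← map_sum, this, map_neg, map_one]
  have h3 : ∑ t : ZMod p, (a + ZMod.castHom dvd_rfl K t) ^ j =
      ∑ i ∈ Finset.range (j + 1), (∑ t : ZMod p, (ZMod.castHom dvd_rfl K t) ^ i) *
        (a ^ (j - i) * j.choose i) := by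
    simp only [add_comm a, add_pow, Finset.sum_mul, mul_assoc]
    exact Finset.sum_comm
  -- In the binomial expansion, power sums of exponent below `p - 1` vanish; as `j ≤ p - 1`, only
  -- the top term can survive, which removes the dependence on `a`.
  rw [h3, Finset.sum_range_succ, Finset.sum_eq_zero, zero_add]
  · split_ifs with h
    · rw [h, h2]; simp
    · rw [h1 j (by omega), zero_mul]
  · intro i hi
    rw [Finset.mem_range] at hi
    rw [h1 i (by omega), zero_mul]

/-- The diagonal representation of `x` in the split symbol algebra. -/
theorem CharPSymbolAlgebra.exists_diagonal (hp : p.Prime) [NeZero p] [CharP F p] (α : F)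
    (K : Type*) [Field K] [IsAlgClosed K] [Algebra F K] :
    ∃ d : ZMod p → K, (∀ t, d (t + 1) = d t + 1) ∧
      (∀ t, d t ^ p = algebraMap F K α + d t) ∧ Function.Injective d ∧
      ∀ j < p, ∑ t, d t ^ j = if j = p - 1 then algebraMap F K (-1) else 0 := by
  have : Fact p.Prime := ⟨hp⟩
  have : CharP K p := charP_of_injective_algebraMap (algebraMap F K).injective p
  obtain ⟨a, ha⟩ : ∃ a : K, a ^ p = algebraMap F K α + a := by
    have hdeg : (Polynomial.X ^ p - Polynomial.X - Polynomial.C (algebraMap F K α)).degree ≠ 0 := by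
      have h1 : (Polynomial.X ^ p - Polynomial.X - Polynomial.C (algebraMap F K α)).degree =
          (p : WithBot ℕ) := by
        rw [sub_sub]
        refine (Polynomial.degree_sub_eq_left_of_degree_lt ?_).trans (Polynomial.degree_X_pow p)
        rw [Polynomial.degree_X_pow]
        refine (Polynomial.degree_add_le _ _).trans_lt (max_lt ?_ ?_)
        · rw [Polynomial.degree_X]; exact_mod_cast hp.one_lt
        · exact Polynomial.degree_C_le.trans_lt (by exact_mod_cast hp.pos)
      rw [h1]
      exact_mod_cast hp.ne_zero
    obtain ⟨a, ha⟩ := IsAlgClosed.exists_root _ hdeg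
    refine ⟨a, ?_⟩
    simp only [Polynomial.IsRoot, Polynomial.eval_sub, Polynomial.eval_pow, Polynomial.eval_X,
      Polynomial.eval_C] at ha
    linear_combination ha
  refine ⟨fun t => a + ZMod.castHom dvd_rfl K t, fun t => ?_, fun t => ?_, fun t t' h => ?_,
    fun j hj => ?_⟩
  · simp only [map_add, map_one, add_assoc]
  · rw [add_pow_char, ← map_pow, ZMod.pow_card, ha, add_assoc]
  · exact (ZMod.castHom dvd_rfl K).injective (add_left_cancel h)
  · rw [ZMod.sum_add_castHom_pow hp a hj]
    simp

end CharPSymbol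

/-! ### The two cases of the characteristic -/

theorem symbolTensor_rank_le {p : ℕ} (hp : p.Prime) {m : ℕ} {F₀ F : Type u} [Field F₀] [Field F]
    (hchar : ringChar F₀ = 0 ∨ p ≤ ringChar F₀) (hne : ringChar F₀ ≠ p)
    {c : F₀ →+* F} {α β : Fin m → F}
    (hW : ∃ (Γ : Type) (_ : AddCommGroup Γ) (_ : LinearOrder Γ) (_ : IsOrderedAddMonoid Γ),
      Nonempty (IndepValuation c α β Γ))
    {ρ : F₀} (hρ : IsPrimitiveRoot ρ p) (V : Submodule F (SymbolTensor p m (c ρ) α β))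
    (hV : ∀ a ∈ V, reducedTrace F (a ^ (p - 1)) = 0) :
    Module.rank F V ≤ (((p ^ (2 * m) - 1) / (p - 1) : ℕ) : Cardinal) := by
  have : NeZero p := ⟨hp.ne_zero⟩
  obtain ⟨Γ, _, _, _, ⟨W⟩⟩ := id hW
  choose d hd hd' hinj hsum using fun i => SymbolAlgebra.exists_diagonal hp
    (hρ.map_of_injective c.injective) (W.alpha_ne_zero i) (AlgebraicClosure F)
  choose b hb using fun i => IsAlgClosed.exists_pow_nat_eq
    (algebraMap F (AlgebraicClosure F) (β i)) hp.pos
  have hb0 : ∀ i, b i ≠ 0 := by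
    intro i h
    have := hb i
    rw [h, zero_pow hp.ne_zero] at this
    exact W.beta_ne_zero i ((map_eq_zero _).1 this.symm)
  choose φ hφ using fun i =>
    SymbolAlgebra.exists_symbolRep (hd i) (hd' i) (hb i) (hinj i) (hb0 i)
  have hpF : (p : F) ≠ 0 := by
    rw [← map_natCast c, map_ne_zero]
    intro h
    rcases (Nat.dvd_prime hp).1 ((ringChar.spec F₀ p).1 h) with h1 | h1
    · exact CharP.ringChar_ne_one h1
    · exact hne h1
  -- Here `j₀ = 0` and `τ = p`, the trace of `1` in each factor.
  exact rank_le_of_symbolGens hp hchar hW (hρ.ne_zero hp.ne_zero) (ε := 0)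
    (fun i => by rw [map_zero]; exact SymbolAlgebra.symbolGens p (c ρ) (α i) (β i)) hφ
    (Or.inl rfl) hp.pos hpF hsum V hV

theorem charPSymbolTensor_rank_le {p : ℕ} (hp : p.Prime) {m : ℕ} {F₀ F : Type u} [Field F₀]
    [Field F] (hchar : ringChar F₀ = p) {c : F₀ →+* F} {α β : Fin m → F}
    (hW : ∃ (Γ : Type) (_ : AddCommGroup Γ) (_ : LinearOrder Γ) (_ : IsOrderedAddMonoid Γ),
      Nonempty (IndepValuation c α β Γ))
    (V : Submodule F (CharPSymbolTensor p m α β))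
    (hV : ∀ a ∈ V, reducedTrace F (a ^ (p - 1)) = 0) :
    Module.rank F V ≤ (((p ^ (2 * m) - 1) / (p - 1) : ℕ) : Cardinal) := by
  have : NeZero p := ⟨hp.ne_zero⟩
  obtain ⟨Γ, _, _, _, ⟨W⟩⟩ := id hW
  have : CharP F₀ p := ringChar.of_eq hchar
  have : CharP F p := charP_of_injective_ringHom c.injective p
  choose d hd hd' hinj hsum using fun i =>
    CharPSymbolAlgebra.exists_diagonal hp (α i) (AlgebraicClosure F)
  choose b hb using fun i => IsAlgClosed.exists_pow_nat_eq
    (algebraMap F (AlgebraicClosure F) (β i)) hp.pos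
  have hb0 : ∀ i, b i ≠ 0 := by
    intro i h
    have := hb i
    rw [h, zero_pow hp.ne_zero] at this
    exact W.beta_ne_zero i ((map_eq_zero _).1 this.symm)
  choose φ hφ using fun i =>
    CharPSymbolAlgebra.exists_symbolRep (hd i) (hd' i) (hb i) (hinj i) (hb0 i)
  -- Here `j₀ = p - 1` and `τ = -1`, the sum of the `(p - 1)`-st powers over the prime field.
  exact rank_le_of_symbolGens hp (Or.inr hchar.ge) hW (ρ := 1) (ε := 1) one_ne_zero
    (fun i => by rw [map_one]; exact CharPSymbolAlgebra.symbolGens p (α i) (β i)) hφ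
    (Or.inr rfl) (Nat.sub_lt hp.pos one_pos) (neg_ne_zero.2 one_ne_zero) hsum V hV

end

theorem mainTheorem1 (p : ℕ) (hp : p.Prime) (m : ℕ) (F₀ : Type u) [Field F₀]
    (hchar : ringChar F₀ = 0 ∨ p ≤ ringChar F₀) :
    (ringChar F₀ ≠ p → ∀ ρ : F₀, IsPrimitiveRoot ρ p →
      (∀ V : Submodule (RatField m F₀)
          (SymbolTensor p m (algebraMap F₀ (RatField m F₀) ρ)
            (RatField.alpha m F₀) (RatField.beta m F₀)),
        (∀ v ∈ V, reducedTrace (RatField m F₀) (v ^ (p - 1)) = 0) →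
          Module.rank (RatField m F₀) V ≤ (((p ^ (2 * m) - 1) / (p - 1) : ℕ) : Cardinal)) ∧
      (∀ V : Submodule (IterLaurent m F₀)
          (SymbolTensor p m (IterLaurent.const m F₀ ρ)
            (IterLaurent.alpha m F₀) (IterLaurent.beta m F₀)),
        (∀ v ∈ V, reducedTrace (IterLaurent m F₀) (v ^ (p - 1)) = 0) →
          Module.rank (IterLaurent m F₀) V ≤ (((p ^ (2 * m) - 1) / (p - 1) : ℕ) : Cardinal))) ∧
    (ringChar F₀ = p →
      (∀ V : Submodule (RatField m F₀)
          (CharPSymbolTensor p m (RatField.alpha m F₀) (RatField.beta m F₀)),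
        (∀ v ∈ V, reducedTrace (RatField m F₀) (v ^ (p - 1)) = 0) →
          Module.rank (RatField m F₀) V ≤ (((p ^ (2 * m) - 1) / (p - 1) : ℕ) : Cardinal)) ∧
      (∀ V : Submodule (IterLaurent m F₀)
          (CharPSymbolTensor p m (IterLaurent.alpha m F₀) (IterLaurent.beta m F₀)),
        (∀ v ∈ V, reducedTrace (IterLaurent m F₀) (v ^ (p - 1)) = 0) →
          Module.rank (IterLaurent m F₀) V ≤ (((p ^ (2 * m) - 1) / (p - 1) : ℕ) : Cardinal))) := by
  refine ⟨fun hne ρ hρ => ⟨fun V hV => ?_, fun V hV => ?_⟩,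
    fun heq => ⟨fun V hV => ?_, fun V hV => ?_⟩⟩
  · exact symbolTensor_rank_le hp hchar hne (RatField.exists_indepValuation m F₀) hρ V hV
  · exact symbolTensor_rank_le hp hchar hne (IterLaurent.exists_indepValuation m F₀) hρ V hV
  · exact charPSymbolTensor_rank_le hp heq (RatField.exists_indepValuation m F₀) V hV
  · exact charPSymbolTensor_rank_le hp heq (IterLaurent.exists_indepValuation m F₀) V hV
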